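/- **Setting.** Let $\mathfrak g$ be a finite-dimensional real Lie algebra with a fixed norm and open unit ball $\mathbb B$, and let $U(\mathfrak g)$ be its universal enveloping algebra. Locally convex spaces are complex, $\mathrm{cs}(E)$ denotes the continuous seminorms of $E$, tensor products of locally convex spaces carry the projective topology, and representations are by linear operators. For a representation $\varrho$ of $\mathfrak g$ on a locally convex space $E$, $R\ge 0$, $r\ge 0$ and $q\in\mathrm{cs}(E)$ put $$p^{(R)}_{r,q}(v)=\sum_{n=0}^\infty n!^{R-1}r^n\sup_{\xi_1,\dots,\xi_n\in\mathbb B}q(\xi_1\cdots\xi_n\triangleright v)\in[0,\infty],$$ and for $r_0>0$ let $A_{R,r_0}(\varrho)$ be the space of all $v\in E$ with $p^{(R)}_{r,q}(v)<\infty$ for all $q\in\mathrm{cs}(E)$, $0\le r<r_0$, with the locally convex topology given by these seminorms. A *fully reduced inductive system* in $V$ consists of subspaces $V_\alpha\subseteq V$ ($\alpha$ in a directed set $J_V$) with union $V$, each with its own locally convex topology, such that $V_\alpha\subseteq V_\beta$ with continuous inclusion for $\alpha\le\beta$; $V=\varinjlim V_\alpha$ carries the finest locally convex topology making all inclusions continuous.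 An *inductive $\mathfrak g$-triple* consists of such inductive limits $V=\varinjlim V_\alpha$, $W=\varinjlim W_\beta$, $X=\varinjlim X_\gamma$ with representations of $\mathfrak g$ by continuous operators, leaving all $V_\alpha,W_\beta,X_\gamma$ invariant and restricting to continuous operators on them (written $\varrho_{V,\alpha},\varrho_{W,\beta},\varrho_{X,\gamma}$), and a linear map $\mu\colon V\otimes W\to X$ such that for all $\alpha,\beta$ there is a $\gamma$ for which $\mu\colon V_\alpha\otimes W_\beta\to X_\gamma$ is well defined and continuous. It is *malleable* if $\xi\triangleright\mu(v\otimes w)=\mu((\xi\triangleright v)\otimes w+v\otimes(\xi\triangleright w))$. Finally, $A_R(V)=\varinjlim_{r>0,\alpha}A_{R,r}(\varrho_{V,\alpha})=\bigcup_{r,\alpha}A_{R,r}(\varrho_{V,\alpha})$ (indices ordered by decreasing $r$ and increasing $\alpha$), and likewise for $W$, $X$. **Theorem.** Let $\mu\colon V\otimes W\to X$ be an inductive malleable $\mathfrak g$-triple such that every $X_\gamma$ is sequentially complete and Hausdorff, let $R\ge0$, and let $F_\hbar=\sum_{n\ge0}\frac{\hbar^n}{n!}F_n\in(U(\mathfrak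 g)\otimes U(\mathfrak g))[[\hbar]]$. For $\alpha,\beta$, $r_1,r_2,t,s>0$ and $K\subseteq\mathbb C$ compact, let $(\ast)$ be the condition: for all $q_\alpha\in\mathrm{cs}(V_\alpha)$, $q_\beta\in\mathrm{cs}(W_\beta)$ there are $q_\alpha'\in\mathrm{cs}(V_\alpha)$, $q_\beta'\in\mathrm{cs}(W_\beta)$ and $C>0$ with $$\bigl(p^{(R)}_{r,q_\alpha}\otimes p^{(R)}_{r,q_\beta}\bigr)\Bigl(\tfrac{\hbar^n}{n!}F_n\triangleright(v\otimes w)\Bigr)\le C\,p^{(R)}_{tr,q_\alpha'}(v)\,p^{(R)}_{tr,q_\beta'}(w)$$ for all $v\in A_{R,r_1}(\varrho_{V,\alpha})$, $w\in A_{R,r_2}(\varrho_{W,\beta})$, $0<r<s$, $\hbar\in K$ and $n\in\mathbb N_0$. Here the left-hand side is the projective tensor product of the (possibly infinite) seminorms on $A_{R,r_1}(\varrho_{V,\alpha})\otimes A_{R,r_2}(\varrho_{W,\beta})$. Assume that for all $\alpha,\beta$, $r_1,r_2>0$ and compact $K\subseteq\mathbb C$ there is $t>0$ such that $(\ast)$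 holds with $s=\frac{2^{-R}}{t}\min\{r_1,r_2\}$. Then for every $\hbar\in\mathbb C$ and $z\in A_R(V)\otimes A_R(W)$ the series $$\mu_{F_\hbar}(z)=\sum_{n=0}^\infty\frac{\hbar^n}{n!}\,\mu(F_n\triangleright z)$$ converges in some $A_{R,r}(\varrho_{X,\gamma})$ with $r>0$, and $(A_R(V),A_R(W),A_R(X))$ with the restricted representations, the inductive systems above and the map $\mu_{F_\hbar}$ is an inductive $\mathfrak g$-triple. Moreover, let $\alpha,\beta,\gamma$ be such that $\mu\colon V_\alpha\otimes W_\beta\to X_\gamma$ is well defined and continuous, let $r_1,r_2>0$, let $K\subseteq\mathbb C$ be compact, and let $t,s>0$ satisfy $ts\le\min\{r_1,r_2\}$ and $(\ast)$. Then $$K^\circ\times\bigl(A_{R,r_1}(\varrho_{V,\alpha})\otimes A_{R,r_2}(\varrho_{W,\beta})\bigr)\to A_{R,r_0}(\varrho_{X,\gamma}),\qquad(\hbar,z)\mapsto\mu_{F_\hbar}(z),\qquad r_0=2^{-R}s,$$ is well defined and Fréchet holomorphic, i.e. continuous and Gâteaux holomorphic (for every base point in the domain, every direction and every continuous linear functional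 on the target, the resulting scalar function of one complex variable is holomorphic near $0$). -/

import Mathlib

open Filter Topology TensorProduct
open scoped ENNReal

noncomputable section

attribute [local instance 100] LieRing.ofAssociativeRing

namespace GTriple

/-! ### Locally convex topologies -/

/-- `t` is a (complex) locally convex vector space topology. -/
def IsLCTopology {V : Type*} [AddCommGroup V] [Module ℂ V] (t : TopologicalSpace V) : Prop :=
  @IsTopologicalAddGroup V t _ ∧ @ContinuousSMul ℂ V _ _ t ∧ @LocallyConvexSpace ℝ V _ _ _ _ t

/-- Sequential completeness of a topological vector space. -/
def IsSeqComplete (E : Type*) [AddCommGroup E] [TopologicalSpace E] : Prop :=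
  ∀ u : ℕ → E, (∀ U ∈ 𝓝 (0 : E), ∃ n₀, ∀ m ≥ n₀, ∀ n ≥ n₀, u m - u n ∈ U) →
    ∃ x, Tendsto u atTop (𝓝 x)

/-- The projective topology on `E ⊗ F`: the finest locally convex topology for which the canonical
bilinear map `E × F → E ⊗ F` is (jointly) continuous. -/
instance projectiveTopology {E F : Type*} [AddCommGroup E] [Module ℂ E] [TopologicalSpace E]
    [AddCommGroup F] [Module ℂ F] [TopologicalSpace F] : TopologicalSpace (E ⊗[ℂ] F) :=
  sInf {t | IsLCTopology t ∧
    @Continuous (E × F) (E ⊗[ℂ] F) _ t (fun x => x.1 ⊗ₜ[ℂ] x.2)}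

/-- The locally convex inductive limit topology: the finest locally convex topology on `V` for
which all the maps `ι α : E α → V` are continuous. -/
@[reducible]
def inductiveTopology {J : Type*} {E : J → Type*} {V : Type*} [∀ α, AddCommGroup (E α)]
    [∀ α, Module ℂ (E α)] [∀ α, TopologicalSpace (E α)] [AddCommGroup V] [Module ℂ V]
    (ι : ∀ α, E α →ₗ[ℂ] V) : TopologicalSpace V :=
  sInf {t | IsLCTopology t ∧ ∀ α, @Continuous (E α) V _ t (ι α)}

/-- Fréchet holomorphy of a map between locally convex spaces on an open set `U`: continuity on `U`
together with Gâteaux holomorphy, that is, for all `x ∈ U`, all directions `y` and all continuous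
functionals `φ`, the function `s ↦ φ (f (x + s y))` is holomorphic near `0`. -/
def FrechetHolomorphicOn {E F : Type*} [AddCommGroup E] [Module ℂ E] [TopologicalSpace E]
    [AddCommGroup F] [Module ℂ F] [TopologicalSpace F] (f : E → F) (U : Set E) : Prop :=
  ContinuousOn f U ∧
    ∀ x ∈ U, ∀ (y : E) (φ : F →L[ℂ] ℂ), AnalyticAt ℂ (fun s : ℂ => φ (f (x + s • y))) 0

/-- The projective tensor product of two (possibly infinite) seminorms `p` on `P ⊆ E` and `q` on
`Q ⊆ F`, evaluated at an element `u` of `P ⊗ Q ⊆ E ⊗ F`: the infimum of `∑ p(xᵢ) q(yᵢ)` over all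
finite representations `u = ∑ xᵢ ⊗ yᵢ` with `xᵢ ∈ P` and `yᵢ ∈ Q`. -/
def tensorSeminorm {E F : Type*} [AddCommGroup E] [Module ℂ E] [AddCommGroup F] [Module ℂ F]
    (P : Submodule ℂ E) (Q : Submodule ℂ F) (p : E → ℝ≥0∞) (q : F → ℝ≥0∞) (u : E ⊗[ℂ] F) : ℝ≥0∞ :=
  ⨅ (l : List (P × Q)) (_ : (l.map fun a => (a.1 : E) ⊗ₜ[ℂ] (a.2 : F)).sum = u),
    (l.map fun a => p a.1 * q a.2).sum

/-- Representations of a real Lie algebra `𝔤` by linear endomorphisms of a complex vector space. -/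
abbrev Rep (𝔤 V : Type*) [LieRing 𝔤] [LieAlgebra ℝ 𝔤] [AddCommGroup V] [Module ℂ V] : Type _ :=
  𝔤 →ₗ⁅ℝ⁆ Module.End ℂ V

/-! ### Analytic vectors -/

section Analytic

variable {𝔤 : Type*} [LieRing 𝔤] [LieAlgebra ℝ 𝔤]
  {E : Type*} [AddCommGroup E] [Module ℂ E]

/-- The supremum of `q (ξ₁ ⋯ ξₙ ▷ v)` over all `ξ₁, …, ξₙ` in the open unit ball of the norm `N`
on the Lie algebra. -/
def wordSup (N : Seminorm ℝ 𝔤) (ϱ : Rep 𝔤 E) (q : Seminorm ℂ E) (n : ℕ) (v : E) :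
    ℝ≥0∞ :=
  ⨆ ξ : Fin n → {ξ : 𝔤 // N ξ < 1},
    ENNReal.ofReal (q ((List.ofFn fun i => ϱ (ξ i : 𝔤)).prod v))

/-- The possibly infinite seminorm
`p_{r,q}^{(R)}(v) = ∑ₙ n!^{R-1} rⁿ sup_{ξ₁,…,ξₙ ∈ 𝔹} q (ξ₁ ⋯ ξₙ ▷ v)`. -/
def analyticSeminorm (N : Seminorm ℝ 𝔤) (ϱ : Rep 𝔤 E) (R : ℝ) (q : Seminorm ℂ E)
    (r : ℝ) (v : E) : ℝ≥0∞ :=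
  ∑' n : ℕ, ENNReal.ofReal ((n.factorial : ℝ) ^ (R - 1) * r ^ n) * wordSup N ϱ q n v

variable (N : Seminorm ℝ 𝔤) (ϱ : Rep 𝔤 E) (R : ℝ) (q : Seminorm ℂ E) (r : ℝ)

theorem wordSup_add_le (n : ℕ) (v w : E) :
    wordSup N ϱ q n (v + w) ≤ wordSup N ϱ q n v + wordSup N ϱ q n w := by
  refine iSup_le fun ξ => ?_
  rw [map_add]
  refine (ENNReal.ofReal_le_ofReal (map_add_le_add q _ _)).trans ?_
  rw [ENNReal.ofReal_add (apply_nonneg q _) (apply_nonneg q _)]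
  exact add_le_add
    (le_iSup (fun ξ : Fin n → {ξ : 𝔤 // N ξ < 1} =>
      ENNReal.ofReal (q ((List.ofFn fun i => ϱ (ξ i : 𝔤)).prod v))) ξ)
    (le_iSup (fun ξ : Fin n → {ξ : 𝔤 // N ξ < 1} =>
      ENNReal.ofReal (q ((List.ofFn fun i => ϱ (ξ i : 𝔤)).prod w))) ξ)

theorem wordSup_smul (n : ℕ) (c : ℂ) (v : E) :
    wordSup N ϱ q n (c • v) = ENNReal.ofReal ‖c‖ * wordSup N ϱ q n v := by
  unfold wordSup
  rw [ENNReal.mul_iSup]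
  refine iSup_congr fun ξ => ?_
  rw [map_smul, map_smul_eq_mul, ENNReal.ofReal_mul (norm_nonneg c)]

theorem analyticSeminorm_add_le (v w : E) :
    analyticSeminorm N ϱ R q r (v + w) ≤
      analyticSeminorm N ϱ R q r v + analyticSeminorm N ϱ R q r w := by
  unfold analyticSeminorm
  rw [← ENNReal.tsum_add]
  refine ENNReal.tsum_le_tsum fun n => ?_
  rw [← mul_add]
  gcongr
  exact wordSup_add_le N ϱ q n v w

theorem analyticSeminorm_smul (c : ℂ) (v : E) :
    analyticSeminorm N ϱ R q r (c • v) = ENNReal.ofReal ‖c‖ * analyticSeminorm N ϱ R q r v := by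
  unfold analyticSeminorm
  rw [← ENNReal.tsum_mul_left]
  refine tsum_congr fun n => ?_
  rw [wordSup_smul, mul_left_comm]

variable [TopologicalSpace E]

/-- The subspace `A_{R,r₀}(ϱ)` of analytic vectors of order `R` and radius of convergence at
least `r₀`. -/
def analyticVectors (r₀ : ℝ) : Submodule ℂ E where
  carrier := {v | ∀ q : Seminorm ℂ E, Continuous q → ∀ r : ℝ, 0 ≤ r → r < r₀ →
    analyticSeminorm N ϱ R q r v < ∞}
  zero_mem' := fun q _ r _ _ => by
    have h := analyticSeminorm_smul N ϱ R q r 0 0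
    rw [zero_smul, norm_zero, ENNReal.ofReal_zero, zero_mul] at h
    rw [h]
    exact ENNReal.zero_lt_top
  add_mem' := fun hv hw q hq r h0 h1 =>
    (analyticSeminorm_add_le N ϱ R q r _ _).trans_lt
      (ENNReal.add_lt_top.2 ⟨hv q hq r h0 h1, hw q hq r h0 h1⟩)
  smul_mem' := fun c _ hv q hq r h0 h1 => by
    rw [analyticSeminorm_smul]
    exact ENNReal.mul_lt_top ENNReal.ofReal_lt_top (hv q hq r h0 h1)

/-- The space `A_{R,r₀}(ϱ)`, as a type of its own: it does not carry the subspace topology. -/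
def AnalyticSpace (r₀ : ℝ) : Type _ := analyticVectors N ϱ R r₀

namespace AnalyticSpace

variable (r₀ : ℝ)

instance : AddCommGroup (AnalyticSpace N ϱ R r₀) :=
  inferInstanceAs (AddCommGroup (analyticVectors N ϱ R r₀))

instance : Module ℂ (AnalyticSpace N ϱ R r₀) :=
  inferInstanceAs (Module ℂ (analyticVectors N ϱ R r₀))

/-- The inclusion of `A_{R,r₀}(ϱ)` into the representation space. -/
def incl : AnalyticSpace N ϱ R r₀ →ₗ[ℂ] E := (analyticVectors N ϱ R r₀).subtype

/-- The index set of the defining seminorms of `A_{R,r₀}(ϱ)`; the index `none` stands for the zero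
seminorm, which does not influence the topology. -/
abbrev Index : Type _ :=
  Option ({q : Seminorm ℂ E // Continuous q} × {r : ℝ // 0 ≤ r ∧ r < r₀})

/-- The seminorms `p_{r,q}^{(R)}`, restricted to `A_{R,r₀}(ϱ)`. -/
def seminorms : SeminormFamily ℂ (AnalyticSpace N ϱ R r₀) (Index (E := E) r₀)
  | none => 0
  | some i => Seminorm.of
      (fun v => (analyticSeminorm N ϱ R i.1.1 i.2.1 (incl N ϱ R r₀ v)).toReal)
      (fun v w => by
        have hv : analyticSeminorm N ϱ R i.1.1 i.2.1 (incl N ϱ R r₀ v) < ∞ :=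
          v.2 i.1.1 i.1.2 i.2.1 i.2.2.1 i.2.2.2
        have hw : analyticSeminorm N ϱ R i.1.1 i.2.1 (incl N ϱ R r₀ w) < ∞ :=
          w.2 i.1.1 i.1.2 i.2.1 i.2.2.1 i.2.2.2
        rw [map_add, ← ENNReal.toReal_add hv.ne hw.ne]
        exact ENNReal.toReal_mono (ENNReal.add_ne_top.2 ⟨hv.ne, hw.ne⟩)
          (analyticSeminorm_add_le N ϱ R _ _ _ _))
      (fun c v => by
        rw [map_smul, analyticSeminorm_smul, ENNReal.toReal_mul,
          ENNReal.toReal_ofReal (norm_nonneg c)])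

/-- The locally convex topology of `A_{R,r₀}(ϱ)`, induced by the seminorms `p_{r,q}^{(R)}` with
`q` continuous and `0 ≤ r < r₀`. -/
instance : TopologicalSpace (AnalyticSpace N ϱ R r₀) :=
  (seminorms N ϱ R r₀).moduleFilterBasis.topology

theorem withSeminorms : WithSeminorms (seminorms N ϱ R r₀) := ⟨rfl⟩

instance : IsTopologicalAddGroup (AnalyticSpace N ϱ R r₀) :=
  (withSeminorms N ϱ R r₀).topologicalAddGroup

instance : ContinuousSMul ℂ (AnalyticSpace N ϱ R r₀) :=
  (withSeminorms N ϱ R r₀).continuousSMul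

instance : LocallyConvexSpace ℝ (AnalyticSpace N ϱ R r₀) :=
  (withSeminorms N ϱ R r₀).toLocallyConvexSpace

end AnalyticSpace

end Analytic

/-! ### Inductive `𝔤`-triples -/

section Triples

variable {𝔤 : Type*} [LieRing 𝔤] [LieAlgebra ℝ 𝔤]

/-- `V` is the locally convex inductive limit of the fully reduced inductive system of the locally
convex spaces `E α`, regarded as subspaces of `V` through the injections `ι α`, and `ϱ` is a
representation on `V` which leaves all `E α` invariant, restricting to the representations
`ϱE α` by continuous linear operators. -/
structure IsInductiveRep {J : Type*} [Preorder J] {E : J → Type*} [∀ α, AddCommGroup (E α)]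
    [∀ α, Module ℂ (E α)] [tE : ∀ α, TopologicalSpace (E α)] {V : Type*} [AddCommGroup V] [Module ℂ V]
    (ι : ∀ α, E α →ₗ[ℂ] V) (ϱ : Rep 𝔤 V)
    (ϱE : ∀ α, Rep 𝔤 (E α)) : Prop where
  isLC : ∀ α, IsLCTopology (tE α)
  directed : ∀ α β : J, ∃ γ, α ≤ γ ∧ β ≤ γ
  injective : ∀ α, Function.Injective (ι α)
  exhaustive : ∀ v : V, ∃ α, ∃ x : E α, ι α x = v
  connecting : ∀ α β, α ≤ β → ∃ φ : E α →L[ℂ] E β, ∀ x, ι β (φ x) = ι α x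
  invariant : ∀ α ξ x, ι α (ϱE α ξ x) = ϱ ξ (ι α x)
  continuous_piece : ∀ α ξ, Continuous (ϱE α ξ)
  continuous_limit : ∀ ξ, @Continuous V V (inductiveTopology ι) (inductiveTopology ι) (ϱ ξ)

/-- `μ` restricts to a well-defined continuous linear map `E ⊗ F → G` on subspaces
`E ⊆ V`, `F ⊆ W`, `G ⊆ X`, where `E ⊗ F` carries the projective topology. -/
def RestrictsContinuously {E F G V W X : Type*}
    [AddCommGroup E] [Module ℂ E] [TopologicalSpace E]
    [AddCommGroup F] [Module ℂ F] [TopologicalSpace F]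
    [AddCommGroup G] [Module ℂ G] [TopologicalSpace G]
    [AddCommGroup V] [Module ℂ V] [AddCommGroup W] [Module ℂ W] [AddCommGroup X] [Module ℂ X]
    (i : E →ₗ[ℂ] V) (j : F →ₗ[ℂ] W) (k : G →ₗ[ℂ] X) (μ : V ⊗[ℂ] W →ₗ[ℂ] X) : Prop :=
  ∃ m : E ⊗[ℂ] F →ₗ[ℂ] G, (∀ z, k (m z) = μ (TensorProduct.map i j z)) ∧ Continuous m

/-- Inductive `𝔤`-triples. -/
structure IsInductiveTriple {JV JW JX : Type*} [Preorder JV] [Preorder JW] [Preorder JX]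
    {EV : JV → Type*} [∀ α, AddCommGroup (EV α)] [∀ α, Module ℂ (EV α)]
    [∀ α, TopologicalSpace (EV α)]
    {EW : JW → Type*} [∀ β, AddCommGroup (EW β)] [∀ β, Module ℂ (EW β)]
    [∀ β, TopologicalSpace (EW β)]
    {EX : JX → Type*} [∀ γ, AddCommGroup (EX γ)] [∀ γ, Module ℂ (EX γ)]
    [∀ γ, TopologicalSpace (EX γ)]
    {V W X : Type*} [AddCommGroup V] [Module ℂ V] [AddCommGroup W] [Module ℂ W]
    [AddCommGroup X] [Module ℂ X]
    (ιV : ∀ α, EV α →ₗ[ℂ] V) (ιW : ∀ β, EW β →ₗ[ℂ] W) (ιX : ∀ γ, EX γ →ₗ[ℂ] X)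
    (ϱV : Rep 𝔤 V) (ϱW : Rep 𝔤 W) (ϱX : Rep 𝔤 X)
    (ϱEV : ∀ α, Rep 𝔤 (EV α)) (ϱEW : ∀ β, Rep 𝔤 (EW β))
    (ϱEX : ∀ γ, Rep 𝔤 (EX γ)) (μ : V ⊗[ℂ] W →ₗ[ℂ] X) : Prop where
  left : IsInductiveRep ιV ϱV ϱEV
  right : IsInductiveRep ιW ϱW ϱEW
  target : IsInductiveRep ιX ϱX ϱEX
  continuity : ∀ α β, ∃ γ, RestrictsContinuously (ιV α) (ιW β) (ιX γ) μ

/-- Malleability: the Leibniz rule for the actions with respect to `μ`. -/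
def IsMalleable {V W X : Type*} [AddCommGroup V] [Module ℂ V] [AddCommGroup W] [Module ℂ W]
    [AddCommGroup X] [Module ℂ X] (ϱV : Rep 𝔤 V)
    (ϱW : Rep 𝔤 W) (ϱX : Rep 𝔤 X) (μ : V ⊗[ℂ] W →ₗ[ℂ] X) : Prop :=
  ∀ ξ v w, ϱX ξ (μ (v ⊗ₜ w)) = μ (ϱV ξ v ⊗ₜ w + v ⊗ₜ ϱW ξ w)

/-- The action of `U(𝔤) ⊗ U(𝔤)` on `V ⊗ W`, where the first factor acts on `V` and the second one
on `W`. -/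
def tensorAction {V W : Type*} [AddCommGroup V] [Module ℂ V] [AddCommGroup W] [Module ℂ W]
    (ϱV : Rep 𝔤 V) (ϱW : Rep 𝔤 W) :
    UniversalEnvelopingAlgebra ℝ 𝔤 ⊗[ℝ] UniversalEnvelopingAlgebra ℝ 𝔤 →ₗ[ℝ]
      Module.End ℂ (V ⊗[ℂ] W) :=
  TensorProduct.lift (LinearMap.mk₂ ℝ
    (fun a b => TensorProduct.map (UniversalEnvelopingAlgebra.lift ℝ ϱV a)
      (UniversalEnvelopingAlgebra.lift ℝ ϱW b))
    (fun a a' b => by rw [map_add, TensorProduct.map_add_left])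
    (fun c a b => by
      ext v w
      simp [TensorProduct.smul_tmul'])
    (fun a b b' => by rw [map_add, TensorProduct.map_add_right])
    (fun c a b => by
      ext v w
      simp))

/-- The space `A_R(ϱ)` of analytic vectors of order `R` of an inductive limit, as a subspace of the
limit: the (directed) union of all `A_{R,r}(ϱ_α)` with `r > 0`. -/
def analyticUnion {J : Type*} {E : J → Type*} [∀ α, AddCommGroup (E α)] [∀ α, Module ℂ (E α)]
    [∀ α, TopologicalSpace (E α)] {V : Type*} [AddCommGroup V] [Module ℂ V]
    (N : Seminorm ℝ 𝔤) (ι : ∀ α, E α →ₗ[ℂ] V) (ϱE : ∀ α, Rep 𝔤 (E α)) (R : ℝ) :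
    Submodule ℂ V :=
  ⨆ (p : {r : ℝ // 0 < r} × J), (analyticVectors N (ϱE p.2) R p.1.1).map (ι p.2)

/-- The inclusion of `A_{R,r}(ϱ_α)` with `r > 0` into `A_R(ϱ)`. The index set is directed by
decreasing `r` and increasing `α`. -/
def analyticIncl {J : Type*} {E : J → Type*} [∀ α, AddCommGroup (E α)] [∀ α, Module ℂ (E α)]
    [∀ α, TopologicalSpace (E α)] {V : Type*} [AddCommGroup V] [Module ℂ V]
    (N : Seminorm ℝ 𝔤) (ι : ∀ α, E α →ₗ[ℂ] V) (ϱE : ∀ α, Rep 𝔤 (E α)) (R : ℝ)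
    (p : {r : ℝ // 0 < r}ᵒᵈ × J) :
    AnalyticSpace N (ϱE p.2) R (OrderDual.ofDual p.1).1 →ₗ[ℂ] analyticUnion N ι ϱE R :=
  LinearMap.codRestrict _ (ι p.2 ∘ₗ AnalyticSpace.incl N (ϱE p.2) R (OrderDual.ofDual p.1).1)
    (fun v => Submodule.mem_iSup_of_mem (p := fun p : {r : ℝ // 0 < r} × J =>
        (analyticVectors N (ϱE p.2) R p.1.1).map (ι p.2)) (OrderDual.ofDual p.1, p.2)
      ⟨_, v.2, rfl⟩)

/-- The equicontinuity condition on the coefficients `Fₙ` of `F_ħ = ∑ₙ ħⁿ/n! Fₙ` for a pair of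
representations on locally convex spaces `E` and `F`: for all continuous seminorms `q₁`, `q₂` there
are continuous seminorms `q₁'`, `q₂'` and `C > 0` with
`(p_{r,q₁} ⊗ p_{r,q₂})(ħⁿ/n! Fₙ ▷ (v ⊗ w)) ≤ C p_{tr,q₁'}(v) p_{tr,q₂'}(w)`
for all `v ∈ A_{R,r₁}`, `w ∈ A_{R,r₂}`, `0 < r < s`, `ħ ∈ K` and `n`. -/
def TwistEquicontinuous {E F : Type*} [AddCommGroup E] [Module ℂ E] [TopologicalSpace E]
    [AddCommGroup F] [Module ℂ F] [TopologicalSpace F]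
    (N : Seminorm ℝ 𝔤) (ϱE : Rep 𝔤 E) (ϱF : Rep 𝔤 F) (R : ℝ)
    (Fh : ℕ → UniversalEnvelopingAlgebra ℝ 𝔤 ⊗[ℝ] UniversalEnvelopingAlgebra ℝ 𝔤)
    (r₁ r₂ : ℝ) (K : Set ℂ) (t s : ℝ) : Prop :=
  ∀ (q₁ : Seminorm ℂ E) (q₂ : Seminorm ℂ F), Continuous q₁ → Continuous q₂ →
    ∃ (q₁' : Seminorm ℂ E) (q₂' : Seminorm ℂ F), Continuous q₁' ∧ Continuous q₂' ∧
      ∃ C : ℝ, 0 < C ∧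
        ∀ v ∈ analyticVectors N ϱE R r₁, ∀ w ∈ analyticVectors N ϱF R r₂,
          ∀ r : ℝ, 0 < r → r < s → ∀ ħ ∈ K, ∀ n : ℕ,
            tensorSeminorm (analyticVectors N ϱE R r₁) (analyticVectors N ϱF R r₂)
                (analyticSeminorm N ϱE R q₁ r) (analyticSeminorm N ϱF R q₂ r)
                ((ħ ^ n / (n.factorial : ℂ)) • tensorAction ϱE ϱF (Fh n) (v ⊗ₜ[ℂ] w)) ≤
              ENNReal.ofReal C * analyticSeminorm N ϱE R q₁' (t * r) v *
                analyticSeminorm N ϱF R q₂' (t * r) w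

end Triples

end GTriple

end

/-! Write `b n` for the map `z ↦ μ(Fₙ ▷ z) / n!`. The deformed product is the power series `∑ ħⁿ b n
z`, and everything follows from one geometric bound on its coefficients.

Malleability is a Leibniz rule, so a word of length `n` acting on a product expands binomially. In
the weight `n!^(R-1) rⁿ` the binomial coefficient ends up with exponent `R`, hence costs at most
`2^(R n)`, and `p_r(μ(v ⊗ w)) ≤ p_{2^R r}(v) p_{2^R r}(w)` (`analyticSeminorm_tensor_le`). This is
the origin of the factor `2^(-R)` in the radius of the target.

The twist condition is used at a single nonzero parameter `κ`. Combined with the Leibniz estimate it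
bounds `p(b n (v ⊗ w)) |κ|ⁿ` by a product of seminorms independent of `n`. The supremum over `n` is
then one continuous seminorm on the projective tensor product
(`TwistEquicontinuous.exists_coefficients`), so the series converges geometrically for `|ħ| < |κ|`,
is jointly continuous and is Gâteaux holomorphic. For compact `K` take `κ` of maximal modulus: the
interior of `K` lies in the open disc of radius `|κ|`. For a fixed `ħ` take `|κ| = |ħ| + 1`.

The sum exists in `X_γ` by sequential completeness, and countable subadditivity of the analytic
seminorms gives both its analyticity and convergence in the finer topology
(`AnalyticSpace.summable`). Sums obtained in different pieces agree because the pieces are directed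
and Hausdorff (`IsSeriesSum.unique`), which yields a global linear map. -/

noncomputable section

attribute [local instance 100] LieRing.ofAssociativeRing

namespace GTriple

/-! ### Locally convex topologies and the projective tensor product -/

section LocallyConvex

variable {E F : Type*} [AddCommGroup E] [Module ℂ E] [AddCommGroup F] [Module ℂ F]

theorem IsLCTopology.sInf {T : Set (TopologicalSpace E)} (hT : ∀ t ∈ T, IsLCTopology t) :
    IsLCTopology (sInf T) :=
  ⟨topologicalAddGroup_sInf fun t ht => (hT t ht).1, continuousSMul_sInf fun t ht => (hT t ht).2.1,
    LocallyConvexSpace.sInf fun t ht => (hT t ht).2.2⟩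

theorem IsLCTopology.induced [t : TopologicalSpace F] (ht : IsLCTopology t) (f : E →ₗ[ℂ] F) :
    IsLCTopology (TopologicalSpace.induced f t) := by
  have := ht.1
  have := ht.2.1
  have := ht.2.2
  exact ⟨topologicalAddGroup_induced f, continuousSMul_induced f,
    LocallyConvexSpace.induced (𝕜 := ℝ) (f.restrictScalars ℝ)⟩

-- Real and complex convexity of a set coincide, so a basis of real convex neighbourhoods already
-- makes the space polynormable over `ℂ`.
open scoped ComplexOrder in
theorem IsLCTopology.withSeminorms [t : TopologicalSpace E] (ht : IsLCTopology t) :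
    WithSeminorms (fun p : {p : Seminorm ℂ E // Continuous p} => p.1) := by
  have := ht.1
  have := ht.2.1
  have := ht.2.2
  have : ContinuousSMul ℝ E := IsScalarTower.continuousSMul ℂ
  have : LocallyConvexSpace ℂ E :=
    LocallyConvexSpace.ofBasisZero ℂ E _ _ (LocallyConvexSpace.convex_open_basis_zero ℝ E)
      fun _ h => convex_RCLike_iff_convex_real.2 h.2.2
  exact PolynormableSpace.withSeminorms ℂ E

/-- Supplies a competitor in the infimum defining the projective topology. -/
theorem isLCTopology_seminorm (P : Seminorm ℂ E) :
    ∃ t : TopologicalSpace E, IsLCTopology t ∧ @Continuous _ _ t _ P ∧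
      @WithSeminorms ℂ E Unit _ _ _ (fun _ => P) t := by
  let t : TopologicalSpace E := (SeminormFamily.moduleFilterBasis (fun _ : Unit => P)).topology
  have h : WithSeminorms (fun _ : Unit => P) := ⟨rfl⟩
  exact ⟨t, ⟨h.topologicalAddGroup, h.continuousSMul, h.toLocallyConvexSpace⟩,
    h.continuous_seminorm (), h⟩

theorem IsLCTopology.exists_seminorm [t : TopologicalSpace E] (ht : IsLCTopology t) {U : Set E}
    (hU : U ∈ 𝓝 0) : ∃ p : Seminorm ℂ E, Continuous p ∧ ∀ x, p x < 1 → x ∈ U := by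
  have := ht.1
  have := ht.2.1
  obtain ⟨⟨s, a⟩, ha, hs⟩ := ht.withSeminorms.hasBasis_zero_ball.mem_iff.1 hU
  lift a to NNReal using le_of_lt ha
  have ha' : (0 : ℝ) < a := ha
  have hc : Continuous ⇑(s.sup fun p : {p : Seminorm ℂ E // Continuous p} => p.1) :=
    Seminorm.continuous (r := a)
      (ht.withSeminorms.hasBasis_zero_ball.mem_of_mem (i := (s, (a : ℝ))) ha)
  -- Rescaling by `a⁻¹` turns the basic ball of radius `a` into a unit ball.
  refine ⟨a⁻¹ • (s.sup fun p : {p : Seminorm ℂ E // Continuous p} => p.1), ?_, fun x hx => hs ?_⟩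
  · exact hc.const_smul (a⁻¹)
  · rw [Seminorm.mem_ball_zero]
    rw [smul_apply, NNReal.smul_def, smul_eq_mul, NNReal.coe_inv, inv_mul_lt_iff₀ ha',
      mul_one] at hx
    exact hx

variable [TopologicalSpace E] [TopologicalSpace F]

theorem isLCTopology_projective : IsLCTopology (projectiveTopology (E := E) (F := F)) :=
  IsLCTopology.sInf fun _ h => h.1

theorem continuous_tmul : Continuous fun x : E × F => x.1 ⊗ₜ[ℂ] x.2 :=
  continuous_sInf_rng.2 fun _ h => h.2

/-- A seminorm on the projective tensor product is continuous if it is bounded on the pure tensors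
by a product of continuous seminorms. -/
theorem continuous_tensor_seminorm (hE : IsLCTopology ‹TopologicalSpace E›)
    (hF : IsLCTopology ‹TopologicalSpace F›) (P : Seminorm ℂ (E ⊗[ℂ] F)) (p : Seminorm ℂ E)
    (q : Seminorm ℂ F) (hp : Continuous p) (hq : Continuous q)
    (h : ∀ v w, P (v ⊗ₜ w) ≤ p v * q w) : Continuous P := by
  have := hE.1
  have := hF.1
  obtain ⟨t, ht, hc, hw⟩ := isLCTopology_seminorm P
  -- The projective topology is the finest admissible one, so it is enough that the topology
  -- generated by `P` alone is admissible.
  have key : @Continuous (E × F) (E ⊗[ℂ] F) _ t fun x => x.1 ⊗ₜ[ℂ] x.2 := by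
    refine continuous_iff_continuousAt.2 fun ⟨v, w⟩ => ?_
    refine (WithSeminorms.tendsto_nhds hw _ _).2 fun _ ε hε => ?_
    have hlim : Tendsto (fun x : E × F => p (x.1 - v) * q x.2 + p v * q (x.2 - w)) (𝓝 (v, w))
        (𝓝 0) := by
      have : Continuous fun x : E × F => p (x.1 - v) * q x.2 + p v * q (x.2 - w) := by fun_prop
      simpa using this.tendsto (v, w)
    filter_upwards [hlim.eventually (gt_mem_nhds hε)] with x hx
    refine lt_of_le_of_lt ?_ hx
    have : x.1 ⊗ₜ[ℂ] x.2 - v ⊗ₜ[ℂ] w = (x.1 - v) ⊗ₜ x.2 + v ⊗ₜ (x.2 - w) := by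
      rw [TensorProduct.sub_tmul, TensorProduct.tmul_sub]; abel
    rw [this]
    exact (map_add_le_add P _ _).trans (add_le_add (h _ _) (h _ _))
  have hle : projectiveTopology (E := E) (F := F) ≤ t := sInf_le ⟨ht, key⟩
  exact continuous_le_dom hle hc

/-- A continuous seminorm of a linear map on the projective tensor product is bounded on the pure
tensors by a product of continuous seminorms. -/
theorem exists_seminorm_mul_bound (hE : IsLCTopology ‹TopologicalSpace E›)
    (hF : IsLCTopology ‹TopologicalSpace F›) (P : Seminorm ℂ (E ⊗[ℂ] F)) (hP : Continuous P) :
    ∃ (p : Seminorm ℂ E) (q : Seminorm ℂ F), Continuous p ∧ Continuous q ∧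
      ∀ v w, P (v ⊗ₜ w) ≤ p v * q w := by
  have hc : Continuous fun x : E × F => P (x.1 ⊗ₜ x.2) := hP.comp continuous_tmul
  have h0 : {x : E × F | P (x.1 ⊗ₜ x.2) < 1} ∈ 𝓝 ((0 : E), (0 : F)) := by
    refine (hc.tendsto (0, 0)).eventually (gt_mem_nhds ?_)
    simp
  rw [nhds_prod_eq] at h0
  obtain ⟨A, hA, B, hB, hAB⟩ := Filter.mem_prod_iff.1 h0
  obtain ⟨p, hp, hpA⟩ := hE.exists_seminorm hA
  obtain ⟨q, hq, hqB⟩ := hF.exists_seminorm hB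
  refine ⟨p, q, hp, hq, fun v w => ?_⟩
  -- Rescaling by numbers strictly above `p v` and `q w` covers the case where one of them vanishes;
  -- the bound itself follows in the limit.
  have key : ∀ a > p v, ∀ b > q w, P (v ⊗ₜ w) ≤ a * b := by
    intro a ha b hb
    have ha0 : 0 < a := (apply_nonneg p v).trans_lt ha
    have hb0 : 0 < b := (apply_nonneg q w).trans_lt hb
    have h1 : P ((((a⁻¹ : ℝ) : ℂ) • v) ⊗ₜ (((b⁻¹ : ℝ) : ℂ) • w)) < 1 := by
      refine hAB (a := (_, _)) ⟨hpA _ ?_, hqB _ ?_⟩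
      · simpa [map_smul_eq_mul, abs_of_pos ha0, inv_mul_lt_iff₀ ha0] using ha
      · simpa [map_smul_eq_mul, abs_of_pos hb0, inv_mul_lt_iff₀ hb0] using hb
    rw [TensorProduct.tmul_smul, map_smul_eq_mul, ← TensorProduct.smul_tmul', map_smul_eq_mul] at h1
    simp only [Complex.norm_real, norm_inv, Real.norm_of_nonneg ha0.le,
      Real.norm_of_nonneg hb0.le] at h1
    rw [← mul_assoc, ← mul_inv, inv_mul_lt_iff₀ (by positivity), mul_one, mul_comm b a] at h1
    exact h1.le
  have hlim : Tendsto (fun ε : ℝ => (p v + ε) * (q w + ε)) (𝓝[>] 0) (𝓝 (p v * q w)) := by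
    have : Continuous fun ε : ℝ => (p v + ε) * (q w + ε) := by fun_prop
    simpa using (this.tendsto 0).mono_left nhdsWithin_le_nhds
  refine ge_of_tendsto hlim ?_
  filter_upwards [self_mem_nhdsWithin] with ε hε
  exact key _ (by simpa using hε) _ (by simpa using hε)

end LocallyConvex

/-! ### Absolutely convergent series -/

section Series

variable {E : Type*} [AddCommGroup E] [Module ℂ E] [TopologicalSpace E]

theorem ofReal_seminorm_le_tsum {ι : Type*} (q : Seminorm ℂ E) (hq : Continuous q) {a : ι → E}
    {x : E} (h : HasSum a x) : ENNReal.ofReal (q x) ≤ ∑' i, ENNReal.ofReal (q (a i)) := by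
  have h1 : Tendsto (fun s : Finset ι => ENNReal.ofReal (q (∑ i ∈ s, a i))) atTop
      (𝓝 (ENNReal.ofReal (q x))) :=
    ((ENNReal.continuous_ofReal.comp hq).tendsto x).comp h
  refine le_of_tendsto' h1 fun s => ?_
  refine le_trans ?_ (ENNReal.sum_le_tsum s)
  rw [← ENNReal.ofReal_sum_of_nonneg fun i _ => apply_nonneg q _]
  exact ENNReal.ofReal_le_ofReal
    (Finset.le_sum_of_subadditive q (map_zero q).le (map_add_le_add q) s a)

/-- Absolutely convergent series converge in sequentially complete locally convex spaces. -/
theorem IsSeqComplete.summable (hE : IsLCTopology ‹TopologicalSpace E›) (hs : IsSeqComplete E)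
    {a : ℕ → E} (h : ∀ q : Seminorm ℂ E, Continuous q → ∑' n, ENNReal.ofReal (q (a n)) ≠ ∞) :
    Summable a := by
  -- Tails are controlled over arbitrary finite sets, since unconditional convergence is the goal.
  have htail : ∀ (q : Seminorm ℂ E) (ε : ℝ), Continuous q → 0 < ε → ∃ s₀ : Finset ℕ,
      ∀ t : Finset ℕ, Disjoint t s₀ → q (∑ i ∈ t, a i) < ε := by
    intro q ε hq hε
    have h1 := (ENNReal.tendsto_tsum_compl_atTop_zero (h q hq)).eventually
      (gt_mem_nhds (ENNReal.ofReal_pos.2 hε))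
    obtain ⟨s₀, h0⟩ := h1.exists
    refine ⟨s₀, fun t ht => ?_⟩
    rw [← ENNReal.ofReal_lt_ofReal_iff hε]
    refine lt_of_le_of_lt ?_ h0
    refine (ENNReal.ofReal_le_ofReal
      (Finset.le_sum_of_subadditive q (map_zero q).le (map_add_le_add q) t a)).trans ?_
    rw [ENNReal.ofReal_sum_of_nonneg fun i _ => apply_nonneg q _]
    have : ∑ i ∈ t, ENNReal.ofReal (q (a i)) =
        ∑' i : t, ENNReal.ofReal (q (a i)) := by
      rw [Finset.tsum_subtype t fun i => ENNReal.ofReal (q (a i))]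
    rw [this]
    exact ENNReal.tsum_mono_subtype (fun i => ENNReal.ofReal (q (a i)))
      (s := (t : Set ℕ)) (t := {i | i ∉ s₀})
      fun i hi => Finset.disjoint_left.1 ht hi
  obtain ⟨x, hx⟩ := hs (fun N => ∑ i ∈ Finset.range N, a i) (by
    intro U hU
    obtain ⟨q, hq, hqU⟩ := hE.exists_seminorm hU
    obtain ⟨s₀, h0⟩ := htail q 1 hq one_pos
    obtain ⟨n₀, hn₀⟩ := s₀.exists_nat_subset_range
    have key : ∀ m ≥ n₀, ∀ n ≥ m,
        q (∑ i ∈ Finset.range n, a i - ∑ i ∈ Finset.range m, a i) < 1 := by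
      intro m hm n hn
      rw [← Finset.sum_sdiff_eq_sub (Finset.range_mono hn)]
      refine h0 _ (Finset.disjoint_left.2 fun i hi hi' => ?_)
      have := Finset.mem_range.1 (hn₀ hi')
      simp only [Finset.mem_sdiff, Finset.mem_range] at hi
      omega
    refine ⟨n₀, fun m hm n hn => hqU _ ?_⟩
    rcases le_total m n with hmn | hmn
    · rw [map_sub_rev]
      exact key m hm n hmn
    · exact key n hn m hmn)
  -- Sequential completeness only gives convergence along initial segments. A large finite set is
  -- compared with a long initial segment containing it; their difference avoids `s₀`.
  refine ⟨x, (hE.withSeminorms.tendsto_nhds _ _).2 fun ⟨q, hq⟩ ε hε => ?_⟩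
  obtain ⟨s₀, h0⟩ := htail q (ε / 2) hq (half_pos hε)
  filter_upwards [eventually_ge_atTop s₀] with s hsub
  have h1 := (hE.withSeminorms.tendsto_nhds _ _).1 hx ⟨q, hq⟩ (ε / 2) (half_pos hε)
  obtain ⟨n₀, hn₀⟩ := s.exists_nat_subset_range
  obtain ⟨n, hn, hn'⟩ := (h1.and (eventually_ge_atTop n₀)).exists
  have h2 : s ⊆ Finset.range n := hn₀.trans (Finset.range_mono hn')
  have h3 := h0 (Finset.range n \ s) (Finset.disjoint_left.2 fun i hi hi' =>
    (Finset.mem_sdiff.1 hi).2 (hsub hi'))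
  rw [Finset.sum_sdiff_eq_sub h2] at h3
  have h4 : ∑ i ∈ s, a i - x = (∑ i ∈ Finset.range n, a i - x) -
    (∑ i ∈ Finset.range n, a i - ∑ i ∈ s, a i) := by abel
  show q (∑ i ∈ s, a i - x) < ε
  rw [h4]
  refine (map_sub_le_add q _ _).trans_lt ?_
  have := add_lt_add hn h3
  simpa using this

end Series

/-! ### Analytic seminorms and series of analytic vectors -/

section Analytic

variable {𝔤 : Type*} [LieRing 𝔤] [LieAlgebra ℝ 𝔤]
  {E : Type*} [AddCommGroup E] [Module ℂ E] (N : Seminorm ℝ 𝔤) (ϱ : Rep 𝔤 E) (R : ℝ)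
  (q : Seminorm ℂ E)

theorem ofReal_le_wordSup {n : ℕ} (ξ : Fin n → {ξ : 𝔤 // N ξ < 1}) (v : E) :
    ENNReal.ofReal (q ((List.ofFn fun i => ϱ (ξ i : 𝔤)).prod v)) ≤ wordSup N ϱ q n v :=
  le_iSup (fun ξ : Fin n → {ξ : 𝔤 // N ξ < 1} =>
      ENNReal.ofReal (q ((List.ofFn fun i => ϱ (ξ i : 𝔤)).prod v))) ξ

theorem wordSup_zero (v : E) : wordSup N ϱ q 0 v = ENNReal.ofReal (q v) := by
  simp [wordSup]

theorem analyticSeminorm_mono {r r' : ℝ} (h0 : 0 ≤ r) (h : r ≤ r') (v : E) :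
    analyticSeminorm N ϱ R q r v ≤ analyticSeminorm N ϱ R q r' v :=
  ENNReal.tsum_le_tsum fun n => by gcongr

/-- The term `n = 0` is exactly `q v`, even for `r = 0`, because `0 ^ 0 = 1`. -/
theorem ofReal_le_analyticSeminorm {r : ℝ} (v : E) :
    ENNReal.ofReal (q v) ≤ analyticSeminorm N ϱ R q r v := by
  refine le_trans ?_ (ENNReal.le_tsum 0)
  simp [wordSup_zero]

variable [TopologicalSpace E]

theorem continuous_list_prod {n : ℕ} (hϱ : ∀ ξ, Continuous (ϱ ξ)) (ξ : Fin n → 𝔤) :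
    Continuous (List.ofFn fun i => ϱ (ξ i)).prod := by
  induction n with
  | zero => simpa using! continuous_id
  | succ n ih =>
    rw [List.ofFn_succ, List.prod_cons]
    exact (hϱ _).comp (ih _)

theorem wordSup_le_tsum (hϱ : ∀ ξ, Continuous (ϱ ξ)) (hq : Continuous q) {ι : Type*} {a : ι → E}
    {x : E} (h : HasSum a x) (n : ℕ) : wordSup N ϱ q n x ≤ ∑' i, wordSup N ϱ q n (a i) := by
  refine iSup_le fun ξ => ?_
  refine (ofReal_seminorm_le_tsum q hq (h.map (List.ofFn fun i => ϱ (ξ i : 𝔤)).prod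
    (continuous_list_prod ϱ hϱ _))).trans ?_
  exact ENNReal.tsum_le_tsum fun i => ofReal_le_wordSup N ϱ q ξ (a i)

/-- Countable subadditivity of the analytic seminorms. -/
theorem analyticSeminorm_le_tsum (hϱ : ∀ ξ, Continuous (ϱ ξ)) (hq : Continuous q) {ι : Type*}
    {a : ι → E} {x : E} (h : HasSum a x) (r : ℝ) :
    analyticSeminorm N ϱ R q r x ≤ ∑' i, analyticSeminorm N ϱ R q r (a i) := by
  unfold analyticSeminorm
  rw [ENNReal.tsum_comm]
  refine ENNReal.tsum_le_tsum fun n => ?_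
  rw [ENNReal.tsum_mul_left]
  gcongr
  exact wordSup_le_tsum N ϱ q hϱ hq h n

namespace AnalyticSpace

variable (r₀ : ℝ)

theorem incl_injective : Function.Injective (incl N ϱ R r₀) := Subtype.val_injective

variable {N ϱ R r₀}

theorem analyticSeminorm_lt_top (v : AnalyticSpace N ϱ R r₀) {q : Seminorm ℂ E}
    (hq : Continuous q) {r : ℝ} (h0 : 0 ≤ r) (h : r < r₀) :
    analyticSeminorm N ϱ R q r (incl N ϱ R r₀ v) < ∞ := v.2 q hq r h0 h

theorem exists_incl_eq {x : E} (hx : x ∈ analyticVectors N ϱ R r₀) :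
    ∃ v : AnalyticSpace N ϱ R r₀, incl N ϱ R r₀ v = x := ⟨⟨x, hx⟩, rfl⟩

theorem incl_mem (v : AnalyticSpace N ϱ R r₀) : incl N ϱ R r₀ v ∈ analyticVectors N ϱ R r₀ := v.2

theorem ofReal_seminorms (i : {q : Seminorm ℂ E // Continuous q} × {r : ℝ // 0 ≤ r ∧ r < r₀})
    (v : AnalyticSpace N ϱ R r₀) :
    ENNReal.ofReal (seminorms N ϱ R r₀ (some i) v) =
      analyticSeminorm N ϱ R i.1.1 i.2.1 (incl N ϱ R r₀ v) :=
  ENNReal.ofReal_toReal (v.2 i.1.1 i.1.2 i.2.1 i.2.2.1 i.2.2.2).ne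

theorem isLCTopology :
    IsLCTopology (inferInstance : TopologicalSpace (AnalyticSpace N ϱ R r₀)) :=
  ⟨inferInstance, inferInstance, inferInstance⟩

/-- The seminorm with `r = 0` dominates `q`; it belongs to the defining family precisely because `0
< r₀`. -/
theorem continuous_incl (hE : IsLCTopology ‹TopologicalSpace E›) (h0 : 0 < r₀) :
    Continuous (incl N ϱ R r₀) := by
  refine hE.withSeminorms.continuous_of_continuous_comp _ fun ⟨q, hq⟩ => ?_
  refine Seminorm.continuous_of_le ((withSeminorms N ϱ R r₀).continuous_seminorm
    (some ⟨⟨q, hq⟩, ⟨0, le_rfl, h0⟩⟩)) fun v => ?_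
  have := ofReal_le_analyticSeminorm N ϱ R q (r := 0) (incl N ϱ R r₀ v)
  rw [← ofReal_seminorms ⟨⟨q, hq⟩, ⟨0, le_rfl, h0⟩⟩] at this
  exact (ENNReal.ofReal_le_ofReal_iff (apply_nonneg _ _)).1 this

theorem t2Space [T2Space E] (hE : IsLCTopology ‹TopologicalSpace E›) (h0 : 0 < r₀) :
    T2Space (AnalyticSpace N ϱ R r₀) :=
  T2Space.of_injective_continuous (incl_injective N ϱ R r₀) (continuous_incl hE h0)

/-- Convergence of absolutely convergent series of analytic vectors. -/
theorem summable (hE : IsLCTopology ‹TopologicalSpace E›) (hs : IsSeqComplete E)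
    (hϱ : ∀ ξ, Continuous (ϱ ξ)) (h0 : 0 < r₀) {a : ℕ → AnalyticSpace N ϱ R r₀}
    (h : ∀ q : Seminorm ℂ E, Continuous q → ∀ r, 0 ≤ r → r < r₀ →
      ∑' n, analyticSeminorm N ϱ R q r (incl N ϱ R r₀ (a n)) ≠ ∞) : Summable a := by
  -- The sum is formed in `E`, where the seminorms at `r = 0` control the series; countable
  -- subadditivity then shows that it is analytic.
  obtain ⟨x, hx⟩ := hs.summable hE (a := fun n => incl N ϱ R r₀ (a n)) fun q hq =>
    ne_top_of_le_ne_top (h q hq 0 le_rfl h0)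
      (ENNReal.tsum_le_tsum fun n => ofReal_le_analyticSeminorm N ϱ R q _)
  obtain ⟨y, rfl⟩ := exists_incl_eq (N := N) (ϱ := ϱ) (R := R) (r₀ := r₀) (x := x)
    fun q hq r hr hr' => (analyticSeminorm_le_tsum N ϱ R q hϱ hq hx r).trans_lt
      (lt_top_iff_ne_top.2 (h q hq r hr hr'))
  have := hE.1
  refine ⟨y, ((withSeminorms N ϱ R r₀).tendsto_nhds _ _).2 fun i ε hε => ?_⟩
  match i with
  | none => exact .of_forall fun _ => hε
  | some i =>
    have h1 := (ENNReal.tendsto_tsum_compl_atTop_zero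
      (h i.1.1 i.1.2 i.2.1 i.2.2.1 i.2.2.2)).eventually (gt_mem_nhds (ENNReal.ofReal_pos.2 hε))
    filter_upwards [h1] with s hs
    rw [map_sub_rev, ← ENNReal.ofReal_lt_ofReal_iff hε, ofReal_seminorms]
    refine lt_of_le_of_lt ?_ hs
    -- The error of a partial sum is the sum in `E` of the remaining terms, so countable
    -- subadditivity bounds it by a tail of a convergent series.
    refine analyticSeminorm_le_tsum N ϱ R i.1.1 hϱ i.1.2 (ι := {n // n ∉ s})
      (a := (fun n => incl N ϱ R r₀ (a n)) ∘ (↑)) ?_ _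
    refine (Finset.hasSum_compl_iff (f := fun n => incl N ϱ R r₀ (a n)) s).2 ?_
    rwa [map_sub, map_sum, sub_add_cancel]

end AnalyticSpace

end Analytic

/-! ### Estimates for the Lie algebra action and for malleable products -/

section Estimates

variable {𝔤 : Type*} [LieRing 𝔤] [LieAlgebra ℝ 𝔤]
  {E : Type*} [AddCommGroup E] [Module ℂ E] (N : Seminorm ℝ 𝔤) (ϱ : Rep 𝔤 E) (R : ℝ)
  (q : Seminorm ℂ E)

/-- The letter `ξ` is appended at the right end of the word, next to `v`. -/
theorem wordSup_action_le {ξ : 𝔤} (hξ : N ξ < 1) (n : ℕ) (v : E) :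
    wordSup N ϱ q n (ϱ ξ v) ≤ wordSup N ϱ q (n + 1) v := by
  refine iSup_le fun ξ' => ?_
  refine le_trans (le_of_eq ?_) (ofReal_le_wordSup N ϱ q (Fin.snoc ξ' ⟨ξ, hξ⟩) v)
  rw [List.ofFn_succ', List.concat_eq_append, List.prod_append, List.prod_singleton,
    Module.End.mul_apply]
  simp only [Fin.snoc_castSucc, Fin.snoc_last]

/-- Dividing by `N ξ + 1` rather than `N ξ` puts `ξ` strictly inside the unit ball and avoids
division by zero. -/
theorem wordSup_action_le_mul (ξ : 𝔤) (n : ℕ) (v : E) :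
    wordSup N ϱ q n (ϱ ξ v) ≤ ENNReal.ofReal (N ξ + 1) * wordSup N ϱ q (n + 1) v := by
  have h0 : 0 < N ξ + 1 := by positivity
  have h1 : N ((N ξ + 1)⁻¹ • ξ) < 1 := by
    rw [map_smul_eq_mul, norm_inv, Real.norm_of_nonneg h0.le, inv_mul_lt_iff₀ h0]
    linarith
  have h2 : ϱ ξ v = ((N ξ + 1 : ℝ) : ℂ) • ϱ ((N ξ + 1)⁻¹ • ξ) v := by
    rw [Complex.coe_smul, map_smul, LinearMap.smul_apply, smul_inv_smul₀ h0.ne']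
  rw [h2, wordSup_smul, Complex.norm_real, Real.norm_of_nonneg h0.le]
  gcongr
  exact wordSup_action_le N ϱ q h1 n v

/-- The ratio of the two weights is `(n+1)^(1-R) (r/r')ⁿ / r'`. For `R ≥ 0` the first factor is at
most `n + 1`, which the geometric factor absorbs. -/
theorem exists_factorial_weight_bound (hR : 0 ≤ R) {r r' : ℝ} (h0 : 0 ≤ r) (h : r < r') :
    ∃ D : ℝ, 0 ≤ D ∧ ∀ n : ℕ, (n.factorial : ℝ) ^ (R - 1) * r ^ n ≤
      D * (((n + 1).factorial : ℝ) ^ (R - 1) * r' ^ (n + 1)) := by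
  have hr' : 0 < r' := h0.trans_lt h
  have hx0 : 0 ≤ r / r' := by positivity
  have hx1 : r / r' < 1 := (div_lt_one hr').2 h
  have hlim : Tendsto (fun n : ℕ => ((n : ℝ) + 1) * (r / r') ^ n) atTop (𝓝 (0 + 0)) := by
    simp only [add_mul, one_mul]
    exact (tendsto_self_mul_const_pow_of_lt_one hx0 hx1).add
      (tendsto_pow_atTop_nhds_zero_of_lt_one hx0 hx1)
  obtain ⟨B, hB⟩ := hlim.bddAbove_range
  have hB' : ∀ n : ℕ, ((n : ℝ) + 1) * (r / r') ^ n ≤ B := fun n => hB ⟨n, rfl⟩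
  have hB0 : 0 ≤ B := le_trans (by positivity) (hB' 0)
  refine ⟨B / r', by positivity, fun n => ?_⟩
  have hn : (1 : ℝ) ≤ (n : ℝ) + 1 := by simp
  have h1 : 1 ≤ ((n : ℝ) + 1) * ((n : ℝ) + 1) ^ (R - 1) := by
    rw [Real.rpow_sub_one (by positivity), mul_div_cancel₀ _ (by positivity)]
    exact Real.one_le_rpow hn hR
  have h2 : ((n + 1).factorial : ℝ) ^ (R - 1) =
      ((n : ℝ) + 1) ^ (R - 1) * (n.factorial : ℝ) ^ (R - 1) := by
    rw [Nat.factorial_succ, Nat.cast_mul, Real.mul_rpow (by positivity) (by positivity)]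
    push_cast; rfl
  have h3 : r ^ n ≤ B / r' * (((n : ℝ) + 1) ^ (R - 1) * r' ^ (n + 1)) := by
    have h4 : ((n : ℝ) + 1) * r ^ n ≤ B * r' ^ n := by
      have := hB' n
      rw [div_pow, ← mul_div_assoc, div_le_iff₀ (by positivity)] at this
      exact this
    calc r ^ n ≤ (((n : ℝ) + 1) * ((n : ℝ) + 1) ^ (R - 1)) * r ^ n :=
          le_mul_of_one_le_left (by positivity) h1
      _ = ((n : ℝ) + 1) ^ (R - 1) * (((n : ℝ) + 1) * r ^ n) := by ring
      _ ≤ ((n : ℝ) + 1) ^ (R - 1) * (B * r' ^ n) := by gcongr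
      _ = _ := by field_simp; ring
  rw [h2]
  calc (n.factorial : ℝ) ^ (R - 1) * r ^ n
      ≤ (n.factorial : ℝ) ^ (R - 1) * (B / r' * (((n : ℝ) + 1) ^ (R - 1) * r' ^ (n + 1))) := by
        gcongr
    _ = _ := by ring

/-- Acting by `ξ` costs an arbitrarily small part of the radius. The spaces `A_{R,r₀}` are defined
by all `r < r₀`, hence are invariant and acted on continuously. -/
theorem analyticSeminorm_action_le (hR : 0 ≤ R) {r r' : ℝ} (h0 : 0 ≤ r) (h : r < r') (ξ : 𝔤) :
    ∃ D : ℝ, 0 ≤ D ∧ ∀ v, analyticSeminorm N ϱ R q r (ϱ ξ v) ≤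
      ENNReal.ofReal D * analyticSeminorm N ϱ R q r' v := by
  obtain ⟨D, hD, hb⟩ := exists_factorial_weight_bound R hR h0 h
  have hN : 0 ≤ N ξ + 1 := by positivity
  refine ⟨D * (N ξ + 1), by positivity, fun v => ?_⟩
  have hshift : ∑' n : ℕ, ENNReal.ofReal (((n + 1).factorial : ℝ) ^ (R - 1) * r' ^ (n + 1)) *
      wordSup N ϱ q (n + 1) v ≤ analyticSeminorm N ϱ R q r' v :=
    ENNReal.tsum_comp_le_tsum_of_injective (add_left_injective 1)
      (fun n => ENNReal.ofReal ((n.factorial : ℝ) ^ (R - 1) * r' ^ n) * wordSup N ϱ q n v)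
  refine le_trans ?_ (mul_le_mul_right hshift _)
  rw [← ENNReal.tsum_mul_left]
  refine ENNReal.tsum_le_tsum fun n => ?_
  calc _ ≤ ENNReal.ofReal (D * (((n + 1).factorial : ℝ) ^ (R - 1) * r' ^ (n + 1))) *
        (ENNReal.ofReal (N ξ + 1) * wordSup N ϱ q (n + 1) v) := by
        exact mul_le_mul' (ENNReal.ofReal_le_ofReal (hb n)) (wordSup_action_le_mul N ϱ q ξ n v)
    _ = _ := by
        rw [ENNReal.ofReal_mul hD, ENNReal.ofReal_mul hD]
        ring

theorem analyticVectors_invariant [TopologicalSpace E] (hR : 0 ≤ R) {r₀ : ℝ} (ξ : 𝔤) {v : E}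
    (hv : v ∈ analyticVectors N ϱ R r₀) : ϱ ξ v ∈ analyticVectors N ϱ R r₀ := by
  intro q hq r h0 h
  obtain ⟨r', h1, h2⟩ := exists_between h
  obtain ⟨D, -, hD⟩ := analyticSeminorm_action_le N ϱ R q hR h0 h1 ξ
  exact (hD v).trans_lt (ENNReal.mul_lt_top ENNReal.ofReal_lt_top (hv q hq r' (h0.trans h1.le) h2))

variable {N ϱ R}

/-- Continuity of a linear map into a space of analytic vectors follows from a bound for each of
the defining seminorms. -/
theorem AnalyticSpace.continuous_of_bound [TopologicalSpace E] {r₀ : ℝ} {T : Type*}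
    [AddCommGroup T] [Module ℂ T] [TopologicalSpace T] [IsTopologicalAddGroup T]
    (f : T →ₗ[ℂ] AnalyticSpace N ϱ R r₀)
    (h : ∀ i : {q : Seminorm ℂ E // Continuous q} × {r : ℝ // 0 ≤ r ∧ r < r₀},
      ∃ P : Seminorm ℂ T, Continuous P ∧
      ∀ x, seminorms N ϱ R r₀ (some i) (f x) ≤ P x) : Continuous f := by
  refine (withSeminorms N ϱ R r₀).continuous_of_continuous_comp f fun i => ?_
  match i with
  | none => exact continuous_const (y := (0 : ℝ))
  | some i =>
    obtain ⟨P, hP, hle⟩ := h i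
    exact Seminorm.continuous_of_le hP hle

variable {F G : Type*} [AddCommGroup F] [Module ℂ F] [AddCommGroup G] [Module ℂ G]
  {ϱF : Rep 𝔤 F} {ϱG : Rep 𝔤 G} {m : E ⊗[ℂ] F →ₗ[ℂ] G} {q}
  {qF : Seminorm ℂ F} {qG : Seminorm ℂ G}

/-- Induction on the word length: the letter nearest to the product is distributed by the Leibniz
rule, and Pascal's rule recombines the two binomial sums. -/
theorem wordSup_tensor_le
    (hm : ∀ ξ v w, ϱG ξ (m (v ⊗ₜ w)) = m (ϱ ξ v ⊗ₜ w) + m (v ⊗ₜ ϱF ξ w))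
    (hq : ∀ v w, qG (m (v ⊗ₜ w)) ≤ q v * qF w) (n : ℕ) (v : E) (w : F) :
    wordSup N ϱG qG n (m (v ⊗ₜ w)) ≤ ∑ ij ∈ Finset.HasAntidiagonal.antidiagonal n,
      n.choose ij.1 • (wordSup N ϱ q ij.1 v * wordSup N ϱF qF ij.2 w) := by
  induction n generalizing v w with
  | zero =>
    simp only [wordSup_zero, Finset.HasAntidiagonal.antidiagonal_zero, Finset.sum_singleton, Nat.choose_self,
      one_smul]
    rw [← ENNReal.ofReal_mul (apply_nonneg q v)]
    exact ENNReal.ofReal_le_ofReal (hq v w)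
  | succ n ih =>
    refine iSup_le fun ξ => ?_
    have h1 : (List.ofFn fun i => ϱG (ξ i : 𝔤)).prod (m (v ⊗ₜ w)) =
        (List.ofFn fun i => ϱG (ξ (Fin.castSucc i) : 𝔤)).prod
          (m (ϱ (ξ (Fin.last n)) v ⊗ₜ w)) +
        (List.ofFn fun i => ϱG (ξ (Fin.castSucc i) : 𝔤)).prod
          (m (v ⊗ₜ ϱF (ξ (Fin.last n)) w)) := by
      rw [← map_add, ← hm, List.ofFn_succ', List.concat_eq_append, List.prod_append,
        List.prod_singleton, Module.End.mul_apply]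
    rw [h1]
    refine (ENNReal.ofReal_le_ofReal (map_add_le_add qG _ _)).trans ?_
    rw [ENNReal.ofReal_add (apply_nonneg _ _) (apply_nonneg _ _),
      Finset.sum_antidiagonal_choose_succ_nsmul
        (fun i j => wordSup N ϱ q i v * wordSup N ϱF qF j w), add_comm]
    refine add_le_add ?_ ?_
    · refine (ofReal_le_wordSup N ϱG qG (fun i => ξ (Fin.castSucc i)) _).trans ((ih _ _).trans ?_)
      refine Finset.sum_le_sum fun ij _ => ?_
      gcongr
      exact wordSup_action_le N ϱF qF (ξ (Fin.last n)).2 _ _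
    · refine (ofReal_le_wordSup N ϱG qG (fun i => ξ (Fin.castSucc i)) _).trans ((ih _ _).trans ?_)
      refine Finset.sum_le_sum fun ij hij => ?_
      -- In this half Pascal's rule produces the coefficient with lower index `ij.2`, the induction
      -- hypothesis the one with `ij.1`; they agree since `ij.1 + ij.2 = n`.
      rw [Nat.choose_symm_of_eq_add (Finset.HasAntidiagonal.mem_antidiagonal.1 hij).symm]
      gcongr
      exact wordSup_action_le N ϱ q (ξ (Fin.last n)).2 _ _

/-- Since `(i+j)!` is the binomial coefficient times `i! j!`, the coefficient occurs with total
exponent `R - 1 + 1 = R`, and it is at most `2^(i+j)`. The hypothesis `R ≥ 0` keeps the inequality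
under the power. -/
theorem factorial_weight_choose_le (hR : 0 ≤ R) {r : ℝ} (hr : 0 ≤ r) (i j : ℕ) :
    (((i + j).factorial : ℝ) ^ (R - 1) * r ^ (i + j)) * ((i + j).choose i : ℝ) ≤
      ((i.factorial : ℝ) ^ (R - 1) * ((2 : ℝ) ^ R * r) ^ i) *
        ((j.factorial : ℝ) ^ (R - 1) * ((2 : ℝ) ^ R * r) ^ j) := by
  have hc : (0 : ℝ) < ((i + j).choose i : ℝ) := by
    exact_mod_cast Nat.choose_pos (Nat.le_add_right i j)
  have h1 : ((i + j).factorial : ℝ) = (i + j).choose i * (i.factorial * j.factorial) := by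
    have := Nat.choose_mul_factorial_mul_factorial (Nat.le_add_right i j)
    rw [Nat.add_sub_cancel_left] at this
    rw [← this]; push_cast; ring
  have h2 : (((i + j).choose i : ℝ)) ^ R ≤ ((2 : ℝ) ^ R) ^ (i + j) := by
    rw [← Real.rpow_natCast, ← Real.rpow_mul (by norm_num), mul_comm R,
      Real.rpow_mul (by norm_num), Real.rpow_natCast]
    gcongr
    exact_mod_cast Nat.choose_le_two_pow (i + j) i
  have h3 : (((i + j).choose i : ℝ)) ^ (R - 1) * ((i + j).choose i : ℝ) =
      ((i + j).choose i : ℝ) ^ R := by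
    rw [Real.rpow_sub_one hc.ne', div_mul_cancel₀ _ hc.ne']
  rw [h1, Real.mul_rpow hc.le (by positivity), Real.mul_rpow (by positivity) (by positivity)]
  calc _ = (((i + j).choose i : ℝ) ^ (R - 1) * ((i + j).choose i : ℝ)) *
        ((i.factorial : ℝ) ^ (R - 1) * (j.factorial : ℝ) ^ (R - 1) * r ^ (i + j)) := by ring
    _ ≤ ((2 : ℝ) ^ R) ^ (i + j) *
        ((i.factorial : ℝ) ^ (R - 1) * (j.factorial : ℝ) ^ (R - 1) * r ^ (i + j)) := by
        rw [h3]; gcongr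
    _ = _ := by ring

theorem ennreal_tsum_mul_tsum_eq_sum_antidiagonal (f g : ℕ → ℝ≥0∞) :
    (∑' i, f i) * ∑' j, g j = ∑' n, ∑ ij ∈ Finset.HasAntidiagonal.antidiagonal n, f ij.1 * g ij.2 := by
  simp_rw [← ENNReal.tsum_mul_right, ← ENNReal.tsum_mul_left]
  rw [← ENNReal.tsum_prod (f := fun i j => f i * g j),
    ← Finset.HasAntidiagonal.sigmaAntidiagonalEquivProd.tsum_eq, ENNReal.tsum_sigma']
  refine tsum_congr fun n => ?_
  rw [tsum_fintype]
  exact Finset.sum_coe_sort (Finset.HasAntidiagonal.antidiagonal n) fun ij : ℕ × ℕ => f ij.1 * g ij.2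

/-- The analytic seminorms of a malleable product. -/
theorem analyticSeminorm_tensor_le (hR : 0 ≤ R)
    (hm : ∀ ξ v w, ϱG ξ (m (v ⊗ₜ w)) = m (ϱ ξ v ⊗ₜ w) + m (v ⊗ₜ ϱF ξ w))
    (hq : ∀ v w, qG (m (v ⊗ₜ w)) ≤ q v * qF w) {r : ℝ} (hr : 0 ≤ r) (v : E) (w : F) :
    analyticSeminorm N ϱG R qG r (m (v ⊗ₜ w)) ≤
      analyticSeminorm N ϱ R q ((2 : ℝ) ^ R * r) v *
        analyticSeminorm N ϱF R qF ((2 : ℝ) ^ R * r) w := by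
  unfold analyticSeminorm
  rw [ennreal_tsum_mul_tsum_eq_sum_antidiagonal]
  refine ENNReal.tsum_le_tsum fun n => ?_
  refine (mul_le_mul_right (wordSup_tensor_le hm hq n v w) _).trans ?_
  rw [Finset.mul_sum]
  refine Finset.sum_le_sum fun ij hij => ?_
  obtain rfl := Finset.HasAntidiagonal.mem_antidiagonal.1 hij
  rw [nsmul_eq_mul, mul_mul_mul_comm, ← mul_assoc]
  rw [← ENNReal.ofReal_mul (by positivity), ← ENNReal.ofReal_natCast,
    ← ENNReal.ofReal_mul (by positivity)]
  exact mul_le_mul' (ENNReal.ofReal_le_ofReal (factorial_weight_choose_le hR hr ij.1 ij.2)) le_rfl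

/-- The analytic seminorms of a malleable product are bounded by projective tensor seminorms. -/
theorem analyticSeminorm_le_tensorSeminorm (hR : 0 ≤ R)
    (hm : ∀ ξ v w, ϱG ξ (m (v ⊗ₜ w)) = m (ϱ ξ v ⊗ₜ w) + m (v ⊗ₜ ϱF ξ w))
    (hq : ∀ v w, qG (m (v ⊗ₜ w)) ≤ q v * qF w) {r : ℝ} (hr : 0 ≤ r)
    (P : Submodule ℂ E) (Q : Submodule ℂ F) (u : E ⊗[ℂ] F) :
    analyticSeminorm N ϱG R qG r (m u) ≤
      tensorSeminorm P Q (analyticSeminorm N ϱ R q ((2 : ℝ) ^ R * r))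
        (analyticSeminorm N ϱF R qF ((2 : ℝ) ^ R * r)) u := by
  refine le_iInf₂ fun l hl => ?_
  rw [← hl]
  clear hl
  induction l with
  | nil =>
    have := analyticSeminorm_smul N ϱG R qG r 0 0
    simp at this
    simp [this]
  | cons a l ih =>
    rw [List.map_cons, List.sum_cons, map_add, List.map_cons, List.sum_cons]
    exact (analyticSeminorm_add_le N ϱG R qG r _ _).trans
      (add_le_add (analyticSeminorm_tensor_le hR hm hq hr _ _) ih)

end Estimates

/-! ### Power series with geometrically bounded coefficients -/

section PowerSeries

variable {T G ι : Type*} [AddCommGroup T] [Module ℂ T] [AddCommGroup G] [Module ℂ G]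
  {p : SeminormFamily ℂ G ι} {b : ℕ → T →ₗ[ℂ] G} {σ : ℝ}

theorem seminorm_powerSeries_term_le {i : ι} {P : Seminorm ℂ T} (hσ : 0 < σ)
    (h : ∀ n z, p i (b n z) * σ ^ n ≤ P z) (n : ℕ) (z : T) (c : ℂ) :
    p i (c • b n z) ≤ ‖c‖ / σ ^ n * P z := by
  rw [map_smul_eq_mul, div_mul_eq_mul_div, mul_div_assoc]
  gcongr
  rw [le_div_iff₀ (by positivity)]
  exact h n z

variable [TopologicalSpace T] [TopologicalSpace G]

theorem seminorm_le_of_hasSum {q : Seminorm ℂ G} (hq : Continuous q) {a : ℕ → G} {x : G}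
    (h : HasSum a x) {u : ℕ → ℝ} {s : ℝ} (hu : HasSum u s) (hle : ∀ n, q (a n) ≤ u n) : q x ≤ s :=
  le_of_tendsto_of_tendsto' ((hq.tendsto x).comp h) hu fun t =>
    (Finset.le_sum_of_subadditive q (map_zero q).le (map_add_le_add q) t a).trans
      (Finset.sum_le_sum fun n _ => hle n)

/-- Comparison with the geometric series of ratio `‖ħ‖ / σ`. Hypothesis `hG` is the only form of
completeness needed: absolutely convergent series converge. -/
theorem powerSeries_summable
    (hG : ∀ a : ℕ → G, (∀ i, Summable fun n => p i (a n)) → Summable a)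
    (hb : ∀ i, ∃ P : Seminorm ℂ T, Continuous P ∧ ∀ n z, p i (b n z) * σ ^ n ≤ P z)
    {ħ : ℂ} (hħ : ‖ħ‖ < σ) (z : T) : Summable fun n => ħ ^ n • b n z := by
  have hσ : 0 < σ := (norm_nonneg ħ).trans_lt hħ
  refine hG _ fun i => ?_
  obtain ⟨P, -, hP⟩ := hb i
  refine Summable.of_nonneg_of_le (fun n => apply_nonneg _ _) (fun n => ?_)
    ((summable_geometric_of_lt_one (by positivity) ((div_lt_one hσ).2 hħ)).mul_right (P z))
  refine (seminorm_powerSeries_term_le hσ hP n z (ħ ^ n)).trans_eq ?_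
  rw [norm_pow, div_pow]

theorem FrechetHolomorphicOn.mono {f : T → G} {U U' : Set T} (h : FrechetHolomorphicOn f U)
    (hU : U' ⊆ U) : FrechetHolomorphicOn f U' :=
  ⟨h.1.mono hU, fun x hx => h.2 x (hU hx)⟩

/-- Each difference of terms splits as `ħⁿ b n (z - z₀) + (ħⁿ - ħ₀ⁿ) b n z₀`. The first parts sum to
at most a constant times `P (z - z₀)`, the second to at most `g ħ * P z₀` with `g` continuous at
`ħ₀` and `g ħ₀ = 0`. -/
theorem powerSeries_continuousOn [IsTopologicalAddGroup T] (hp : WithSeminorms p)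
    (hG : ∀ a : ℕ → G, (∀ i, Summable fun n => p i (a n)) → Summable a)
    (hb : ∀ i, ∃ P : Seminorm ℂ T, Continuous P ∧ ∀ n z, p i (b n z) * σ ^ n ≤ P z) :
    ContinuousOn (fun x : ℂ × T => ∑' n, x.1 ^ n • b n x.2) (Metric.ball 0 σ ×ˢ Set.univ) := by
  have := hp.topologicalAddGroup
  rintro ⟨ħ₀, z₀⟩ ⟨h0, -⟩
  rw [mem_ball_zero_iff] at h0
  -- The intermediate radius makes the geometric ratio `σ' / σ` uniform in a neighbourhood of `ħ₀`.
  obtain ⟨σ', h1, h2⟩ := exists_between h0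
  have hσ' : 0 < σ' := (norm_nonneg _).trans_lt h1
  have hσ : 0 < σ := hσ'.trans h2
  refine ContinuousAt.continuousWithinAt ((hp.tendsto_nhds _ _).2 fun i ε hε => ?_)
  obtain ⟨P, hPc, hP⟩ := hb i
  have hgeo : Summable fun n : ℕ => (σ' / σ) ^ n :=
    summable_geometric_of_lt_one (by positivity) ((div_lt_one hσ).2 h2)
  have hbound : ∀ (n : ℕ), ∀ ħ ∈ Metric.ball (0 : ℂ) σ', ‖‖ħ ^ n - ħ₀ ^ n‖ / σ ^ n‖ ≤
      2 * (σ' / σ) ^ n := by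
    intro n ħ hħ
    rw [mem_ball_zero_iff] at hħ
    rw [Real.norm_of_nonneg (by positivity), div_pow, ← mul_div_assoc]
    gcongr
    calc ‖ħ ^ n - ħ₀ ^ n‖ ≤ ‖ħ‖ ^ n + ‖ħ₀‖ ^ n := by
          simpa only [norm_pow] using norm_sub_le (ħ ^ n) (ħ₀ ^ n)
      _ ≤ σ' ^ n + σ' ^ n := by gcongr
      _ = 2 * σ' ^ n := by ring
  let g : ℂ → ℝ := fun ħ => ∑' n : ℕ, ‖ħ ^ n - ħ₀ ^ n‖ / σ ^ n
  have hg : ContinuousAt g ħ₀ :=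
    (continuousOn_tsum (s := Metric.ball (0 : ℂ) σ') (fun n => by fun_prop)
      (hgeo.mul_left 2) hbound).continuousAt
        (Metric.isOpen_ball.mem_nhds (mem_ball_zero_iff.2 h1))
  have hlim : Tendsto (fun x : ℂ × T => (∑' n : ℕ, (σ' / σ) ^ n) * P (x.2 - z₀) + g x.1 * P z₀)
      (𝓝 (ħ₀, z₀)) (𝓝 0) := by
    have hg' : ContinuousAt (fun x : ℂ × T => g x.1) (ħ₀, z₀) :=
      ContinuousAt.comp (f := Prod.fst) (x := (ħ₀, z₀)) hg continuousAt_fst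
    have hP' : ContinuousAt (fun x : ℂ × T => P (x.2 - z₀)) (ħ₀, z₀) :=
      (hPc.comp (by fun_prop : Continuous fun x : ℂ × T => x.2 - z₀)).continuousAt
    have := (hP'.const_mul (∑' n : ℕ, (σ' / σ) ^ n)).add (hg'.mul_const (P z₀))
    simpa [ContinuousAt, g, Pi.add_def] using this
  have hball : ∀ᶠ x : ℂ × T in 𝓝 (ħ₀, z₀), ‖x.1‖ < σ' :=
    (continuous_fst.norm.tendsto (ħ₀, z₀)).eventually (gt_mem_nhds h1)
  filter_upwards [hlim.eventually (gt_mem_nhds hε), hball] with x hx hx'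
  refine lt_of_le_of_lt ?_ hx
  have hs1 := (powerSeries_summable hG hb (hx'.trans h2) x.2).hasSum
  have hs2 := (powerSeries_summable hG hb h0 z₀).hasSum
  refine seminorm_le_of_hasSum (hp.continuous_seminorm i) (hs1.sub hs2)
    ((hgeo.hasSum.mul_right _).add
      ((Summable.of_norm_bounded (hgeo.mul_left 2)
        fun n => hbound n x.1 (mem_ball_zero_iff.2 hx')).hasSum.mul_right _)) fun n => ?_
  have h3 : x.1 ^ n • b n x.2 - ħ₀ ^ n • b n z₀ =
      x.1 ^ n • b n (x.2 - z₀) + (x.1 ^ n - ħ₀ ^ n) • b n z₀ := by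
    rw [map_sub, smul_sub, sub_smul]; abel
  rw [h3]
  refine (map_add_le_add _ _ _).trans (add_le_add ?_ ?_)
  · refine (seminorm_powerSeries_term_le hσ hP n _ _).trans ?_
    rw [norm_pow, ← div_pow]
    gcongr
  · exact seminorm_powerSeries_term_le hσ hP n _ _

/-- Scalar summability is absolute, so convergence at one point `σ'` beyond `‖ħ₀‖` dominates the
series uniformly on the disc of radius `σ'`. -/
theorem analyticAt_scalar_powerSeries {c : ℕ → ℂ}
    (hc : ∀ ħ : ℂ, ‖ħ‖ < σ → Summable fun n => ħ ^ n * c n) {ħ₀ : ℂ} (h0 : ‖ħ₀‖ < σ) :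
    AnalyticAt ℂ (fun ħ => ∑' n, ħ ^ n * c n) ħ₀ := by
  obtain ⟨σ', h1, h2⟩ := exists_between h0
  have hσ' : 0 < σ' := (norm_nonneg _).trans_lt h1
  have hs : Summable fun n => σ' ^ n * ‖c n‖ := by
    have := (hc (σ' : ℂ) (by rwa [Complex.norm_real, Real.norm_of_nonneg hσ'.le])).norm
    simpa [abs_of_pos hσ'] using this
  refine (Complex.differentiableOn_tsum_of_summable_norm (U := Metric.ball 0 σ') hs
    (fun n => by fun_prop) Metric.isOpen_ball fun n ħ hħ => ?_).analyticAt
      (Metric.isOpen_ball.mem_nhds (mem_ball_zero_iff.2 h1))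
  rw [norm_mul, norm_pow]
  rw [mem_ball_zero_iff] at hħ
  gcongr

theorem frechetHolomorphicOn_powerSeries [IsTopologicalAddGroup T] (hp : WithSeminorms p)
    (hG : ∀ a : ℕ → G, (∀ i, Summable fun n => p i (a n)) → Summable a)
    (hb : ∀ i, ∃ P : Seminorm ℂ T, Continuous P ∧ ∀ n z, p i (b n z) * σ ^ n ≤ P z) :
    FrechetHolomorphicOn (fun x : ℂ × T => ∑' n, x.1 ^ n • b n x.2)
      (Metric.ball 0 σ ×ˢ Set.univ) := by
  refine ⟨powerSeries_continuousOn hp hG hb, ?_⟩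
  rintro ⟨ħ₀, z⟩ ⟨h0, -⟩ ⟨η, y⟩ φ
  rw [mem_ball_zero_iff] at h0
  have hs : ∀ (z : T) (ħ : ℂ), ‖ħ‖ < σ →
      HasSum (fun n => ħ ^ n * φ (b n z)) (φ (∑' n, ħ ^ n • b n z)) := by
    intro z ħ hħ
    have := (powerSeries_summable hG hb hħ z).hasSum.map φ φ.continuous
    simpa [Function.comp_def] using this
  have hA : ∀ z : T, AnalyticAt ℂ
      (fun s : ℂ => ∑' n, (ħ₀ + s * η) ^ n * φ (b n z)) 0 := by
    intro z
    have h1 : AnalyticAt ℂ (fun ħ : ℂ => ∑' n, ħ ^ n * φ (b n z)) (ħ₀ + 0 * η) :=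
      analyticAt_scalar_powerSeries (σ := σ) (fun ħ hħ => (hs z ħ hħ).summable)
        (by simpa using h0)
    exact h1.comp (g := fun ħ : ℂ => ∑' n, ħ ^ n * φ (b n z)) (f := fun s : ℂ => ħ₀ + s * η)
      (by fun_prop)
  -- Linearity of `b n` on the line through `z` in direction `y` gives the function as `A_z(s) + s
  -- A_y(s)`, with both scalar series analytic.
  refine ((hA z).add (analyticAt_id.mul (hA y))).congr ?_
  have hball : ∀ᶠ s : ℂ in 𝓝 0, ‖ħ₀ + s * η‖ < σ := by
    have : Continuous fun s : ℂ => ‖ħ₀ + s * η‖ := by fun_prop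
    exact (this.tendsto 0).eventually (gt_mem_nhds (by simpa using h0))
  filter_upwards [hball] with s hs'
  have h2 := (hs z _ hs').add ((hs y _ hs').mul_left s)
  have h3 := hs (z + s • y) _ hs'
  have h4 : (fun n => (ħ₀ + s * η) ^ n * φ (b n (z + s • y))) = fun n =>
      (ħ₀ + s * η) ^ n * φ (b n z) + s * ((ħ₀ + s * η) ^ n * φ (b n y)) := by
    funext n
    simp only [map_add, map_smul, smul_eq_mul]
    ring
  rw [h4] at h3
  show ∑' n, (ħ₀ + s * η) ^ n * φ (b n z) + s * ∑' n, (ħ₀ + s * η) ^ n * φ (b n y) =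
    φ (∑' n, (ħ₀ + s • η) ^ n • b n (z + s • y))
  rw [(hs z _ hs').tsum_eq, (hs y _ hs').tsum_eq, smul_eq_mul]
  exact h2.unique h3

variable [T2Space G]

theorem exists_powerSeries_linearMap [IsTopologicalAddGroup T] (hp : WithSeminorms p)
    (hG : ∀ a : ℕ → G, (∀ i, Summable fun n => p i (a n)) → Summable a)
    (hb : ∀ i, ∃ P : Seminorm ℂ T, Continuous P ∧ ∀ n z, p i (b n z) * σ ^ n ≤ P z)
    {ħ : ℂ} (hħ : ‖ħ‖ < σ) :
    ∃ m : T →ₗ[ℂ] G, (∀ z, m z = ∑' n, ħ ^ n • b n z) ∧ Continuous m := by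
  have := hp.topologicalAddGroup
  have := hp.continuousSMul
  refine ⟨⟨⟨fun z => ∑' n, ħ ^ n • b n z, fun z w => ?_⟩, fun c z => ?_⟩, fun _ => rfl, ?_⟩
  · rw [← (powerSeries_summable hG hb hħ z).tsum_add (powerSeries_summable hG hb hħ w)]
    simp
  · simp only [map_smul, RingHom.id_apply]
    rw [← (powerSeries_summable hG hb hħ z).tsum_const_smul c]
    exact tsum_congr fun n => smul_comm _ _ _
  · have h := powerSeries_continuousOn hp hG hb
    rw [← continuousOn_univ]
    exact h.comp (f := fun z : T => (ħ, z)) (by fun_prop)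
      fun z _ => ⟨mem_ball_zero_iff.2 hħ, trivial⟩

end PowerSeries

/-- Subadditivity carries a bound on pure tensors to a pointwise bound everywhere, which is what
makes the supremum of the family a genuine seminorm. -/
theorem bddAbove_tensor_seminorm {E F : Type*} [AddCommGroup E] [Module ℂ E] [AddCommGroup F]
    [Module ℂ F] {P : ℕ → Seminorm ℂ (E ⊗[ℂ] F)} {B : E → F → ℝ}
    (h : ∀ n v w, P n (v ⊗ₜ w) ≤ B v w) : BddAbove (Set.range P) := by
  rw [Seminorm.bddAbove_range_iff]
  intro z
  induction z using TensorProduct.induction_on with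
  | zero => exact ⟨0, by rintro _ ⟨n, rfl⟩; simp⟩
  | tmul v w => exact ⟨B v w, by rintro _ ⟨n, rfl⟩; exact h n v w⟩
  | add x y hx hy =>
    obtain ⟨a, ha⟩ := hx
    obtain ⟨b, hb⟩ := hy
    refine ⟨a + b, ?_⟩
    rintro _ ⟨n, rfl⟩
    exact (map_add_le_add (P n) x y).trans (add_le_add (ha ⟨n, rfl⟩) (hb ⟨n, rfl⟩))

/-! ### Uniform bounds for the coefficients of the deformed product -/

section Coefficients

variable {𝔤 : Type*} [LieRing 𝔤] [LieAlgebra ℝ 𝔤] {N : Seminorm ℝ 𝔤}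
  {E F G : Type*} [AddCommGroup E] [Module ℂ E] [AddCommGroup F] [Module ℂ F]
  [AddCommGroup G] [Module ℂ G] [TopologicalSpace E] [TopologicalSpace F] [TopologicalSpace G]
  {ϱE : Rep 𝔤 E} {ϱF : Rep 𝔤 F} {ϱG : Rep 𝔤 G} {R r₁ r₂ t s : ℝ}
  {m : E ⊗[ℂ] F →ₗ[ℂ] G}
  {Fh : ℕ → UniversalEnvelopingAlgebra ℝ 𝔤 ⊗[ℝ] UniversalEnvelopingAlgebra ℝ 𝔤}

theorem TwistEquicontinuous.mono {K K' : Set ℂ}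
    (h : TwistEquicontinuous N ϱE ϱF R Fh r₁ r₂ K t s) (hK : K' ⊆ K) :
    TwistEquicontinuous N ϱE ϱF R Fh r₁ r₂ K' t s := by
  intro q₁ q₂ h₁ h₂
  obtain ⟨q₁', q₂', h₁', h₂', C, hC, hb⟩ := h q₁ q₂ h₁ h₂
  exact ⟨q₁', q₂', h₁', h₂', C, hC, fun v hv w hw r h0 hr ħ hħ n =>
    hb v hv w hw r h0 hr ħ (hK hħ) n⟩

/-- The bound on the coefficients of the deformed product which follows from the equicontinuity of
the twist and malleability. -/
theorem TwistEquicontinuous.analyticSeminorm_le {κ : ℂ} (hR : 0 ≤ R)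
    (hE : IsLCTopology ‹TopologicalSpace E›) (hF : IsLCTopology ‹TopologicalSpace F›)
    (hmc : Continuous m)
    (hm : ∀ ξ v w, ϱG ξ (m (v ⊗ₜ w)) = m (ϱE ξ v ⊗ₜ w) + m (v ⊗ₜ ϱF ξ w))
    (ht : 0 < t) (hts : t * s ≤ min r₁ r₂)
    (h : TwistEquicontinuous N ϱE ϱF R Fh r₁ r₂ {κ} t s)
    {q : Seminorm ℂ G} (hq : Continuous q) {r : ℝ} (h0 : 0 ≤ r) (hr : r < (2 : ℝ) ^ (-R) * s) :
    ∃ (q₁ : Seminorm ℂ E) (q₂ : Seminorm ℂ F) (C ρ : ℝ), Continuous q₁ ∧ Continuous q₂ ∧ 0 ≤ C ∧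
      0 ≤ ρ ∧ ρ < r₁ ∧ ρ < r₂ ∧
      ∀ v ∈ analyticVectors N ϱE R r₁, ∀ w ∈ analyticVectors N ϱF R r₂, ∀ n : ℕ,
        analyticSeminorm N ϱG R q r
          (m ((κ ^ n / (n.factorial : ℂ)) • tensorAction ϱE ϱF (Fh n) (v ⊗ₜ w))) ≤
        ENNReal.ofReal C * analyticSeminorm N ϱE R q₁ ρ v * analyticSeminorm N ϱF R q₂ ρ w := by
  -- The twist condition requires a positive radius, whereas `r = 0` is allowed here; hence the
  -- passage to `r' > r`.
  obtain ⟨r', hr1, hr2⟩ := exists_between hr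
  have hr' : 0 < r' := h0.trans_lt hr1
  have h2R : (0 : ℝ) < (2 : ℝ) ^ R := by positivity
  have hs : (2 : ℝ) ^ R * r' < s := by
    rwa [Real.rpow_neg zero_le_two, lt_inv_mul_iff₀ h2R] at hr2
  obtain ⟨p₁, p₂, hp₁, hp₂, hp⟩ := exists_seminorm_mul_bound hE hF (q.comp m) (hq.comp hmc)
  obtain ⟨q₁, q₂, hq₁, hq₂, C, hC, hb⟩ := h p₁ p₂ hp₁ hp₂
  -- The inequality is strict, so the radius on the right of the twist bound indexes a defining
  -- seminorm of both source spaces.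
  have hρ : t * ((2 : ℝ) ^ R * r') < min r₁ r₂ := (mul_lt_mul_of_pos_left hs ht).trans_le hts
  refine ⟨q₁, q₂, C, t * ((2 : ℝ) ^ R * r'), hq₁, hq₂, hC.le, by positivity,
    hρ.trans_le (min_le_left _ _), hρ.trans_le (min_le_right _ _), fun v hv w hw n => ?_⟩
  refine (analyticSeminorm_mono N ϱG R q h0 hr1.le _).trans ?_
  refine (analyticSeminorm_le_tensorSeminorm hR hm hp hr'.le (analyticVectors N ϱE R r₁)
    (analyticVectors N ϱF R r₂) _).trans ?_
  exact hb v hv w hw _ (by positivity) hs κ rfl n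

/-- The coefficients of the deformed product as maps between spaces of analytic vectors. -/
theorem TwistEquicontinuous.exists_coefficients {κ : ℂ} (hR : 0 ≤ R)
    (hE : IsLCTopology ‹TopologicalSpace E›) (hF : IsLCTopology ‹TopologicalSpace F›)
    (hmc : Continuous m)
    (hm : ∀ ξ v w, ϱG ξ (m (v ⊗ₜ w)) = m (ϱE ξ v ⊗ₜ w) + m (v ⊗ₜ ϱF ξ w))
    (hκ : κ ≠ 0) (ht : 0 < t) (hts : t * s ≤ min r₁ r₂)
    (h : TwistEquicontinuous N ϱE ϱF R Fh r₁ r₂ {κ} t s) {r₀ : ℝ}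
    (hr₀ : r₀ = (2 : ℝ) ^ (-R) * s) :
    ∃ b : ℕ → AnalyticSpace N ϱE R r₁ ⊗[ℂ] AnalyticSpace N ϱF R r₂ →ₗ[ℂ] AnalyticSpace N ϱG R r₀,
      (∀ n z, AnalyticSpace.incl N ϱG R r₀ (b n z) = (n.factorial : ℂ)⁻¹ •
        m (tensorAction ϱE ϱF (Fh n) (TensorProduct.map (AnalyticSpace.incl N ϱE R r₁)
          (AnalyticSpace.incl N ϱF R r₂) z))) ∧
      ∀ i, ∃ P : Seminorm ℂ (AnalyticSpace N ϱE R r₁ ⊗[ℂ] AnalyticSpace N ϱF R r₂),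
        Continuous P ∧ ∀ n z, AnalyticSpace.seminorms N ϱG R r₀ i (b n z) * ‖κ‖ ^ n ≤ P z := by
  subst hr₀
  let L : ℕ → AnalyticSpace N ϱE R r₁ ⊗[ℂ] AnalyticSpace N ϱF R r₂ →ₗ[ℂ] G := fun n =>
    (n.factorial : ℂ)⁻¹ • m ∘ₗ tensorAction ϱE ϱF (Fh n) ∘ₗ
      TensorProduct.map (AnalyticSpace.incl N ϱE R r₁) (AnalyticSpace.incl N ϱF R r₂)
  have hL : ∀ n v w, m ((κ ^ n / (n.factorial : ℂ)) • tensorAction ϱE ϱF (Fh n)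
      (AnalyticSpace.incl N ϱE R r₁ v ⊗ₜ AnalyticSpace.incl N ϱF R r₂ w)) =
      κ ^ n • L n (v ⊗ₜ w) := by
    intro n v w
    simp [L, div_eq_mul_inv, mul_smul]
  have hLmem : ∀ n z, L n z ∈ analyticVectors N ϱG R ((2 : ℝ) ^ (-R) * s) := by
    intro n z
    induction z using TensorProduct.induction_on with
    | zero => rw [map_zero]; exact Submodule.zero_mem _
    | add x y hx hy => rw [map_add]; exact Submodule.add_mem _ hx hy
    | tmul v w =>
      -- The bound concerns `κⁿ` times the coefficient; membership passes to the coefficient itself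
      -- because `κ ≠ 0`.
      rw [← Submodule.smul_mem_iff _ (pow_ne_zero n hκ)]
      intro q hq r h0 hr
      obtain ⟨q₁, q₂, C, ρ, hq₁, hq₂, -, hρ, h1, h2, hb⟩ :=
        h.analyticSeminorm_le hR hE hF hmc hm ht hts hq h0 hr
      rw [← hL]
      refine (hb _ v.incl_mem _ w.incl_mem n).trans_lt ?_
      exact ENNReal.mul_lt_top (ENNReal.mul_lt_top ENNReal.ofReal_lt_top
        (v.analyticSeminorm_lt_top hq₁ hρ h1)) (w.analyticSeminorm_lt_top hq₂ hρ h2)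
  let b : ℕ → AnalyticSpace N ϱE R r₁ ⊗[ℂ] AnalyticSpace N ϱF R r₂ →ₗ[ℂ]
      AnalyticSpace N ϱG R ((2 : ℝ) ^ (-R) * s) := fun n =>
    LinearMap.codRestrict (analyticVectors N ϱG R ((2 : ℝ) ^ (-R) * s)) (L n) (hLmem n)
  have hbL : ∀ n z, AnalyticSpace.incl N ϱG R _ (b n z) = L n z := fun _ _ => rfl
  refine ⟨b, fun n z => rfl, fun i => ?_⟩
  match i with
  | none => exact ⟨0, continuous_const, fun n z => (zero_mul _).le⟩
  | some i =>
    obtain ⟨q₁, q₂, C, ρ, hq₁, hq₂, hC, hρ, h1, h2, hb⟩ :=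
        h.analyticSeminorm_le hR hE hF hmc hm ht hts i.1.2 i.2.2.1 i.2.2.2
    let S₁ := AnalyticSpace.seminorms N ϱE R r₁ (some ⟨⟨q₁, hq₁⟩, ⟨ρ, hρ, h1⟩⟩)
    let S₂ := AnalyticSpace.seminorms N ϱF R r₂ (some ⟨⟨q₂, hq₂⟩, ⟨ρ, hρ, h2⟩⟩)
    have hpure : ∀ n v w, AnalyticSpace.seminorms N ϱG R _ (some i) (b n (v ⊗ₜ w)) * ‖κ‖ ^ n ≤
        (C * S₁ v) * S₂ w := by
      intro n v w
      rw [← ENNReal.ofReal_le_ofReal_iff (by positivity), mul_comm, ← norm_pow,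
        ← map_smul_eq_mul, AnalyticSpace.ofReal_seminorms, map_smul, hbL, ← hL,
        ENNReal.ofReal_mul (by positivity), ENNReal.ofReal_mul hC,
        AnalyticSpace.ofReal_seminorms, AnalyticSpace.ofReal_seminorms]
      exact hb _ v.incl_mem _ w.incl_mem n
    -- The right-hand side of `hpure` does not depend on `n`, so the supremum of these seminorms
    -- obeys the same bound on pure tensors and is projectively continuous.
    let P : ℕ → Seminorm ℂ (AnalyticSpace N ϱE R r₁ ⊗[ℂ] AnalyticSpace N ϱF R r₂) := fun n =>
      (‖κ‖₊ ^ n) • (AnalyticSpace.seminorms N ϱG R _ (some i)).comp (b n)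
    have hP : ∀ n z, P n z =
        AnalyticSpace.seminorms N ϱG R _ (some i) (b n z) * ‖κ‖ ^ n := by
      intro n z
      rw [mul_comm]
      rfl
    have hbdd : BddAbove (Set.range P) :=
      bddAbove_tensor_seminorm (B := fun v w => (C * S₁ v) * S₂ w)
        fun n v w => (hP n _).trans_le (hpure n v w)
    have hbdd' := Seminorm.bddAbove_range_iff.1 hbdd
    refine ⟨⨆ n, P n, ?_, fun n z => ?_⟩
    · refine continuous_tensor_seminorm AnalyticSpace.isLCTopology AnalyticSpace.isLCTopology _
        (C.toNNReal • S₁) S₂ ?_ ?_ fun v w => ?_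
      · exact ((AnalyticSpace.withSeminorms N ϱE R r₁).continuous_seminorm _).const_smul C.toNNReal
      · exact (AnalyticSpace.withSeminorms N ϱF R r₂).continuous_seminorm _
      · rw [Seminorm.iSup_apply hbdd]
        refine ciSup_le fun n => (hP n _).trans_le ((hpure n v w).trans_eq ?_)
        rw [smul_apply, NNReal.smul_def, Real.coe_toNNReal C hC, smul_eq_mul]
    · rw [Seminorm.iSup_apply hbdd, ← hP]
      exact le_ciSup (hbdd' z) n

end Coefficients

/-! ### Intertwiners, restricted representations and functoriality -/

section Intertwiners

variable {𝔤 : Type*} [LieRing 𝔤] [LieAlgebra ℝ 𝔤]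
  {A B V W : Type*} [AddCommGroup A] [Module ℂ A] [AddCommGroup B] [Module ℂ B]
  [AddCommGroup V] [Module ℂ V] [AddCommGroup W] [Module ℂ W]

/-- `U(𝔤)` is a quotient of the tensor algebra, so it suffices to check scalars, generators,
products and sums. -/
theorem lift_intertwines {ϱA : Rep 𝔤 A} {ϱV : Rep 𝔤 V} {i : A →ₗ[ℂ] V}
    (h : ∀ ξ a, i (ϱA ξ a) = ϱV ξ (i a)) (u : UniversalEnvelopingAlgebra ℝ 𝔤) (a : A) :
    i (UniversalEnvelopingAlgebra.lift ℝ ϱA u a) =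
      UniversalEnvelopingAlgebra.lift ℝ ϱV u (i a) := by
  obtain ⟨u, rfl⟩ : ∃ x, UniversalEnvelopingAlgebra.mkAlgHom ℝ 𝔤 x = u :=
    RingCon.mkₐ_surjective (α := ℝ) (UniversalEnvelopingAlgebra.ringCon ℝ 𝔤) u
  induction u using TensorAlgebra.induction generalizing a with
  | algebraMap c =>
    simp only [AlgHom.commutes, Module.algebraMap_end_apply]
    exact (i.restrictScalars ℝ).map_smul c a
  | ι ξ =>
    have h1 : UniversalEnvelopingAlgebra.mkAlgHom ℝ 𝔤 (TensorAlgebra.ι ℝ ξ) =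
      UniversalEnvelopingAlgebra.ι ℝ ξ := rfl
    rw [h1, UniversalEnvelopingAlgebra.lift_ι_apply, UniversalEnvelopingAlgebra.lift_ι_apply, h]
  | mul x y hx hy => simp only [map_mul, Module.End.mul_apply, hx, hy]
  | add x y hx hy => simp only [map_add, LinearMap.add_apply, hx, hy]

theorem tensorAction_intertwines {ϱA : Rep 𝔤 A} {ϱB : Rep 𝔤 B} {ϱV : Rep 𝔤 V} {ϱW : Rep 𝔤 W}
    {i : A →ₗ[ℂ] V} {j : B →ₗ[ℂ] W} (hi : ∀ ξ a, i (ϱA ξ a) = ϱV ξ (i a))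
    (hj : ∀ ξ b, j (ϱB ξ b) = ϱW ξ (j b))
    (x : UniversalEnvelopingAlgebra ℝ 𝔤 ⊗[ℝ] UniversalEnvelopingAlgebra ℝ 𝔤) (z : A ⊗[ℂ] B) :
    tensorAction ϱV ϱW x (TensorProduct.map i j z) =
      TensorProduct.map i j (tensorAction ϱA ϱB x z) := by
  induction x using TensorProduct.induction_on with
  | zero => simp
  | add x y hx hy => simp only [map_add, LinearMap.add_apply, hx, hy]
  | tmul u u' =>
    induction z using TensorProduct.induction_on with
    | zero => simp
    | add x y hx hy => simp only [map_add, hx, hy]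
    | tmul a b =>
      simp only [tensorAction, TensorProduct.lift.tmul, LinearMap.mk₂_apply,
        TensorProduct.map_tmul, lift_intertwines hi, lift_intertwines hj]

/-- Injectivity of `i` makes the preimages unique and pulls linearity and the bracket relation back
from `V`. -/
theorem exists_subrep {ϱV : Rep 𝔤 V} {i : A →ₗ[ℂ] V} (hi : Function.Injective i)
    (h : ∀ ξ a, ∃ a', i a' = ϱV ξ (i a)) :
    ∃ σ : Rep 𝔤 A, ∀ ξ a, i (σ ξ a) = ϱV ξ (i a) := by
  choose f hf using h
  refine ⟨{ toFun := fun ξ => { toFun := f ξ, map_add' := ?_, map_smul' := ?_ },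
            map_add' := ?_, map_smul' := ?_, map_lie' := ?_ }, hf⟩
  · intro a b; apply hi; simp only [map_add, hf]
  · intro c a; apply hi; simp only [map_smul, hf, RingHom.id_apply]
  · intro ξ η; ext a; apply hi; simp [hf]
  · intro c ξ; ext a; apply hi
    show i (f (c • ξ) a) = i.restrictScalars ℝ (c • f ξ a)
    rw [map_smul, hf, map_smul, LinearMap.restrictScalars_apply, hf]
    rfl
  · intro ξ η; ext a; apply hi
    simp [hf, LieRing.of_associative_ring_bracket]

/-- The topology pulled back along `T` is locally convex and makes every `ι α` continuous, as `T ∘ ι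
α = ι α ∘ S α`; the inductive topology is finer than any such topology. -/
theorem continuous_inductiveTopology {J : Type*} {E : J → Type*} [∀ α, AddCommGroup (E α)]
    [∀ α, Module ℂ (E α)] [∀ α, TopologicalSpace (E α)] (ι : ∀ α, E α →ₗ[ℂ] V)
    (T : V →ₗ[ℂ] V) (S : ∀ α, E α → E α) (hS : ∀ α, Continuous (S α))
    (h : ∀ α x, T (ι α x) = ι α (S α x)) :
    @Continuous V V (inductiveTopology ι) (inductiveTopology ι) T := by
  have hlc : IsLCTopology (inductiveTopology ι) := IsLCTopology.sInf fun _ h => h.1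
  have hι : ∀ α, @Continuous (E α) V _ (inductiveTopology ι) (ι α) := fun α =>
    continuous_sInf_rng.2 fun _ h => h.2 α
  let _ := inductiveTopology ι
  refine continuous_iff_le_induced.2 (sInf_le ⟨hlc.induced T, fun α => ?_⟩)
  refine continuous_induced_rng.2 ?_
  have : T ∘ ι α = ι α ∘ S α := funext fun x => h α x
  rw [this]
  exact (hι α).comp (hS α)

theorem wordSup_comp {ϱA : Rep 𝔤 A} {ϱV : Rep 𝔤 V} {i : A →ₗ[ℂ] V}
    (h : ∀ ξ a, i (ϱA ξ a) = ϱV ξ (i a)) (N : Seminorm ℝ 𝔤) (q : Seminorm ℂ V) (n : ℕ) (a : A) :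
    wordSup N ϱV q n (i a) = wordSup N ϱA (q.comp i) n a := by
  refine iSup_congr fun ξ => ?_
  rw [Seminorm.comp_apply]
  congr 2
  induction n generalizing a with
  | zero => simp
  | succ n ih =>
    simp only [List.ofFn_succ, List.prod_cons, Module.End.mul_apply, h]
    rw [ih]

theorem analyticSeminorm_comp {ϱA : Rep 𝔤 A} {ϱV : Rep 𝔤 V} {i : A →ₗ[ℂ] V}
    (h : ∀ ξ a, i (ϱA ξ a) = ϱV ξ (i a)) (N : Seminorm ℝ 𝔤) (R : ℝ) (q : Seminorm ℂ V) (r : ℝ)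
    (a : A) : analyticSeminorm N ϱV R q r (i a) = analyticSeminorm N ϱA R (q.comp i) r a :=
  tsum_congr fun n => by rw [wordSup_comp h]

/-- Functoriality of the spaces of analytic vectors. -/
theorem AnalyticSpace.exists_map [TopologicalSpace A] [TopologicalSpace V] {ϱA : Rep 𝔤 A}
    {ϱV : Rep 𝔤 V} {i : A →ₗ[ℂ] V} (hi : Continuous i)
    (h : ∀ ξ a, i (ϱA ξ a) = ϱV ξ (i a)) (N : Seminorm ℝ 𝔤) (R : ℝ) {r r' : ℝ} (hr : r' ≤ r) :
    ∃ φ : AnalyticSpace N ϱA R r →L[ℂ] AnalyticSpace N ϱV R r',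
      ∀ x, incl N ϱV R r' (φ x) = i (incl N ϱA R r x) := by
  have hmem : ∀ x : AnalyticSpace N ϱA R r, i (incl N ϱA R r x) ∈ analyticVectors N ϱV R r' := by
    intro x q hq ρ h0 hρ
    rw [analyticSeminorm_comp h]
    exact x.analyticSeminorm_lt_top (hq.comp hi) h0 (hρ.trans_le hr)
  let φ : AnalyticSpace N ϱA R r →ₗ[ℂ] AnalyticSpace N ϱV R r' :=
    LinearMap.codRestrict (analyticVectors N ϱV R r') (i ∘ₗ incl N ϱA R r) hmem
  have hφ : ∀ x, incl N ϱV R r' (φ x) = i (incl N ϱA R r x) := fun _ => rfl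
  refine ⟨⟨φ, continuous_of_bound φ fun j => ?_⟩, hφ⟩
  refine ⟨_, (withSeminorms N ϱA R r).continuous_seminorm
    (some ⟨⟨j.1.1.comp i, j.1.2.comp hi⟩, ⟨j.2.1, j.2.2.1, j.2.2.2.trans_le hr⟩⟩), fun x => ?_⟩
  rw [← ENNReal.ofReal_le_ofReal_iff (apply_nonneg _ _), ofReal_seminorms, ofReal_seminorms, hφ,
    analyticSeminorm_comp h]

/-- The Lie algebra acts on the spaces of analytic vectors by continuous operators. -/
theorem AnalyticSpace.exists_rep [TopologicalSpace V] (ϱV : Rep 𝔤 V) (N : Seminorm ℝ 𝔤) {R : ℝ}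
    (hR : 0 ≤ R) (r₀ : ℝ) : ∃ σ : Rep 𝔤 (AnalyticSpace N ϱV R r₀),
      (∀ ξ a, incl N ϱV R r₀ (σ ξ a) = ϱV ξ (incl N ϱV R r₀ a)) ∧ ∀ ξ, Continuous (σ ξ) := by
  obtain ⟨σ, hσ⟩ := exists_subrep (ϱV := ϱV) (incl_injective N ϱV R r₀) fun ξ a =>
    exists_incl_eq (analyticVectors_invariant N ϱV R hR ξ a.incl_mem)
  refine ⟨σ, hσ, fun ξ => continuous_of_bound (σ ξ) fun i => ?_⟩
  -- Room for the loss of radius, still below `r₀`.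
  obtain ⟨r', h1, h2⟩ := exists_between i.2.2.2
  obtain ⟨D, hD0, hD⟩ := analyticSeminorm_action_le N ϱV R i.1.1 hR i.2.2.1 h1 ξ
  refine ⟨D.toNNReal • seminorms N ϱV R r₀ (some ⟨i.1, ⟨r', i.2.2.1.trans h1.le, h2⟩⟩),
    ((withSeminorms N ϱV R r₀).continuous_seminorm _).const_smul D.toNNReal, fun x => ?_⟩
  rw [smul_apply, NNReal.smul_def, Real.coe_toNNReal D hD0, smul_eq_mul,
    ← ENNReal.ofReal_le_ofReal_iff (by positivity), ENNReal.ofReal_mul hD0, ofReal_seminorms,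
    ofReal_seminorms, hσ]
  exact hD _

end Intertwiners

/-! ### The inductive system of analytic vectors -/

section Inductive

variable {𝔤 : Type*} [LieRing 𝔤] [LieAlgebra ℝ 𝔤] {J : Type*} [Preorder J] {E : J → Type*}
  [∀ α, AddCommGroup (E α)] [∀ α, Module ℂ (E α)] [∀ α, TopologicalSpace (E α)] {V : Type*}
  [AddCommGroup V] [Module ℂ V] {ι : ∀ α, E α →ₗ[ℂ] V} {ϱ : Rep 𝔤 V} {ϱE : ∀ α, Rep 𝔤 (E α)}

theorem coe_analyticIncl {J : Type*} {E : J → Type*} [∀ α, AddCommGroup (E α)]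
    [∀ α, Module ℂ (E α)] [∀ α, TopologicalSpace (E α)] {ι : ∀ α, E α →ₗ[ℂ] V}
    {ϱE : ∀ α, Rep 𝔤 (E α)} (N : Seminorm ℝ 𝔤) (R : ℝ) (p : {r : ℝ // 0 < r}ᵒᵈ × J)
    (x : AnalyticSpace N (ϱE p.2) R (OrderDual.ofDual p.1).1) :
    (analyticIncl N ι ϱE R p x : V) = ι p.2 (AnalyticSpace.incl N (ϱE p.2) R _ x) := rfl

theorem IsInductiveRep.exists_connecting (h : IsInductiveRep ι ϱ ϱE) {α β : J} (hαβ : α ≤ β) :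
    ∃ φ : E α →L[ℂ] E β, (∀ x, ι β (φ x) = ι α x) ∧ ∀ ξ x, φ (ϱE α ξ x) = ϱE β ξ (φ x) := by
  obtain ⟨φ, hφ⟩ := h.connecting α β hαβ
  refine ⟨φ, hφ, fun ξ x => h.injective β ?_⟩
  rw [hφ, h.invariant, h.invariant, hφ]

theorem IsInductiveRep.exists_analytic_connecting (h : IsInductiveRep ι ϱ ϱE) (N : Seminorm ℝ 𝔤)
    (R : ℝ) {p p' : {r : ℝ // 0 < r}ᵒᵈ × J} (hp : p ≤ p') :
    ∃ φ : AnalyticSpace N (ϱE p.2) R (OrderDual.ofDual p.1).1 →L[ℂ]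
        AnalyticSpace N (ϱE p'.2) R (OrderDual.ofDual p'.1).1,
      ∀ x, analyticIncl N ι ϱE R p' (φ x) = analyticIncl N ι ϱE R p x := by
  obtain ⟨φ, hφ, hφ'⟩ := h.exists_connecting hp.2
  obtain ⟨ψ, hψ⟩ := AnalyticSpace.exists_map (i := φ.toLinearMap) φ.continuous hφ' N R
    (r := (OrderDual.ofDual p.1).1) (r' := (OrderDual.ofDual p'.1).1) hp.1
  refine ⟨ψ, fun x => Subtype.ext ?_⟩
  rw [coe_analyticIncl, coe_analyticIncl, hψ]
  exact hφ _

theorem IsInductiveRep.analytic_directed (h : IsInductiveRep ι ϱ ϱE)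
    (p p' : {r : ℝ // 0 < r}ᵒᵈ × J) : ∃ p'', p ≤ p'' ∧ p' ≤ p'' := by
  obtain ⟨γ, h1, h2⟩ := h.directed p.2 p'.2
  exact ⟨(p.1 ⊔ p'.1, γ), ⟨le_sup_left, h1⟩, ⟨le_sup_right, h2⟩⟩

theorem IsInductiveRep.nonempty (h : IsInductiveRep ι ϱ ϱE) : Nonempty J :=
  let ⟨α, _⟩ := h.exhaustive 0
  ⟨α⟩

/-- `analyticUnion` is a supremum of subspaces; directedness of the family makes it a plain union.
-/
theorem IsInductiveRep.analytic_exhaustive (h : IsInductiveRep ι ϱ ϱE) (N : Seminorm ℝ 𝔤) (R : ℝ)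
    (v : analyticUnion N ι ϱE R) : ∃ p x, analyticIncl N ι ϱE R p x = v := by
  have := h.nonempty
  have : Nonempty {r : ℝ // 0 < r} := ⟨⟨1, one_pos⟩⟩
  have hmap : ∀ p : {r : ℝ // 0 < r} × J, ∀ x : V,
      x ∈ (analyticVectors N (ϱE p.2) R p.1.1).map (ι p.2) ↔
        ∃ y, (analyticIncl N ι ϱE R (OrderDual.toDual p.1, p.2) y : V) = x := fun p x =>
    ⟨fun ⟨y, hy, hx⟩ => ⟨⟨y, hy⟩, hx⟩, fun ⟨y, hy⟩ => ⟨_, y.incl_mem, hy⟩⟩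
  have hdir : Directed (· ≤ ·) fun p : {r : ℝ // 0 < r} × J =>
      (analyticVectors N (ϱE p.2) R p.1.1).map (ι p.2) := by
    intro p p'
    obtain ⟨p'', h1, h2⟩ := h.analytic_directed (OrderDual.toDual p.1, p.2)
      (OrderDual.toDual p'.1, p'.2)
    have key : ∀ p : {r : ℝ // 0 < r} × J, (OrderDual.toDual p.1, p.2) ≤ p'' →
        (analyticVectors N (ϱE p.2) R p.1.1).map (ι p.2) ≤
        (analyticVectors N (ϱE p''.2) R (OrderDual.ofDual p''.1).1).map (ι p''.2) := by
      intro p hp x hx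
      obtain ⟨y, rfl⟩ := (hmap p x).1 hx
      obtain ⟨φ, hφ⟩ := h.exists_analytic_connecting N R hp
      exact (hmap (OrderDual.ofDual p''.1, p''.2) _).2 ⟨φ y, congrArg Subtype.val (hφ y)⟩
    exact ⟨(OrderDual.ofDual p''.1, p''.2), key p h1, key p' h2⟩
  obtain ⟨p, hp⟩ := (Submodule.mem_iSup_of_directed _ hdir).1 v.2
  obtain ⟨y, hy⟩ := (hmap p _).1 hp
  exact ⟨_, y, Subtype.ext hy⟩

/-- The analytic vectors of an inductive system of representations form an inductive system of
representations. -/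
theorem IsInductiveRep.analytic (h : IsInductiveRep ι ϱ ϱE) (N : Seminorm ℝ 𝔤) {R : ℝ}
    (hR : 0 ≤ R) : ∃ (σ : Rep 𝔤 (analyticUnion N ι ϱE R))
      (σE : ∀ p : {r : ℝ // 0 < r}ᵒᵈ × J,
        Rep 𝔤 (AnalyticSpace N (ϱE p.2) R (OrderDual.ofDual p.1).1)),
      (∀ ξ v, (σ ξ v : V) = ϱ ξ (v : V)) ∧ IsInductiveRep (analyticIncl N ι ϱE R) σ σE := by
  choose σE hσE hc using fun p : {r : ℝ // 0 < r}ᵒᵈ × J =>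
    AnalyticSpace.exists_rep (ϱE p.2) N hR (OrderDual.ofDual p.1).1
  have hinv : ∀ p ξ x, (analyticIncl N ι ϱE R p (σE p ξ x) : V) =
      ϱ ξ (analyticIncl N ι ϱE R p x : V) := by
    intro p ξ x
    rw [coe_analyticIncl, coe_analyticIncl, hσE, h.invariant]
  obtain ⟨σ, hσ⟩ := exists_subrep (ϱV := ϱ) (i := (analyticUnion N ι ϱE R).subtype)
    Subtype.val_injective fun ξ v => by
      obtain ⟨p, x, rfl⟩ := h.analytic_exhaustive N R v
      exact ⟨analyticIncl N ι ϱE R p (σE p ξ x), hinv p ξ x⟩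
  have hσ' : ∀ p ξ x, analyticIncl N ι ϱE R p (σE p ξ x) = σ ξ (analyticIncl N ι ϱE R p x) :=
    fun p ξ x => Subtype.ext ((hinv p ξ x).trans (hσ ξ (analyticIncl N ι ϱE R p x)).symm)
  refine ⟨σ, σE, hσ, fun p => AnalyticSpace.isLCTopology, h.analytic_directed, fun p x y hxy => ?_,
    h.analytic_exhaustive N R, fun p p' hp => h.exists_analytic_connecting N R hp, hσ', hc,
    fun ξ => continuous_inductiveTopology _ (σ ξ) (fun p => σE p ξ) (fun p => hc p ξ)
      fun p x => (hσ' p ξ x).symm⟩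
  exact AnalyticSpace.incl_injective _ _ _ _ (h.injective _ (congrArg Subtype.val hxy))

end Inductive

theorem AnalyticSpace.summable_of_seminorms {𝔤 : Type*} [LieRing 𝔤] [LieAlgebra ℝ 𝔤] {E : Type*}
    [AddCommGroup E] [Module ℂ E] [TopologicalSpace E] {N : Seminorm ℝ 𝔤} {ϱ : Rep 𝔤 E} {R r₀ : ℝ}
    (hE : IsLCTopology ‹TopologicalSpace E›) (hs : IsSeqComplete E)
    (hϱ : ∀ ξ, Continuous (ϱ ξ)) (h0 : 0 < r₀) (a : ℕ → AnalyticSpace N ϱ R r₀)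
    (h : ∀ i, Summable fun n => seminorms N ϱ R r₀ i (a n)) : Summable a := by
  refine AnalyticSpace.summable hE hs hϱ h0 fun q hq r hr hr' => ?_
  have := (h (some ⟨⟨q, hq⟩, ⟨r, hr, hr'⟩⟩)).tsum_ofReal_ne_top
  simpa only [ofReal_seminorms] using this

/-! ### Series in inductive systems -/

section SeriesSum

variable {J : Type*} {E : J → Type*} [∀ α, AddCommGroup (E α)]
  [∀ α, Module ℂ (E α)] [∀ α, TopologicalSpace (E α)] {V : Type*} [AddCommGroup V] [Module ℂ V]

/-- The series with terms `u n` converges to `x` in one of the spaces of an inductive system. -/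
def IsSeriesSum (ι : ∀ α, E α →ₗ[ℂ] V) (u : ℕ → V) (x : V) : Prop :=
  ∃ α, ∃ (a : ℕ → E α) (y : E α), (∀ n, ι α (a n) = u n) ∧ HasSum a y ∧ ι α y = x

variable [Preorder J] {ι : ∀ α, E α →ₗ[ℂ] V} {𝔤 : Type*} [LieRing 𝔤] [LieAlgebra ℝ 𝔤]
  {ϱ : Rep 𝔤 V} {ϱE : ∀ α, Rep 𝔤 (E α)}

/-- Sums found in different pieces become comparable after moving both along the connecting maps
into one piece. -/
theorem IsInductiveRep.exists_common_seriesSum (h : IsInductiveRep ι ϱ ϱE) {u v : ℕ → V} {x y : V}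
    (hx : IsSeriesSum ι u x) (hy : IsSeriesSum ι v y) :
    ∃ γ, ∃ (a b : ℕ → E γ) (x' y' : E γ), (∀ n, ι γ (a n) = u n) ∧ (∀ n, ι γ (b n) = v n) ∧
      HasSum a x' ∧ HasSum b y' ∧ ι γ x' = x ∧ ι γ y' = y := by
  obtain ⟨α, a, x', ha, hax, hx'⟩ := hx
  obtain ⟨β, b, y', hb, hby, hy'⟩ := hy
  obtain ⟨γ, h1, h2⟩ := h.directed α β
  obtain ⟨φ, hφ⟩ := h.connecting α γ h1
  obtain ⟨ψ, hψ⟩ := h.connecting β γ h2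
  exact ⟨γ, fun n => φ (a n), fun n => ψ (b n), φ x', ψ y', fun n => (hφ _).trans (ha n),
    fun n => (hψ _).trans (hb n), hax.map φ φ.continuous, hby.map ψ ψ.continuous,
    (hφ _).trans hx', (hψ _).trans hy'⟩

/-- Only the pieces have to be Hausdorff; nothing is asked of the limit topology. -/
theorem IsSeriesSum.unique (h : IsInductiveRep ι ϱ ϱE) (hT : ∀ α, T2Space (E α)) {u : ℕ → V}
    {x y : V} (hx : IsSeriesSum ι u x) (hy : IsSeriesSum ι u y) : x = y := by
  obtain ⟨γ, a, b, x', y', ha, hb, hax, hby, rfl, rfl⟩ := h.exists_common_seriesSum hx hy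
  have hab : a = b := funext fun n => h.injective γ ((ha n).trans (hb n).symm)
  have := hT γ
  rw [hax.unique (hab ▸ hby)]

theorem IsSeriesSum.add (h : IsInductiveRep ι ϱ ϱE) {u v : ℕ → V} {x y : V}
    (hx : IsSeriesSum ι u x) (hy : IsSeriesSum ι v y) :
    IsSeriesSum ι (fun n => u n + v n) (x + y) := by
  obtain ⟨γ, a, b, x', y', ha, hb, hax, hby, rfl, rfl⟩ := h.exists_common_seriesSum hx hy
  have := (h.isLC γ).1
  exact ⟨γ, _, _, fun n => by rw [map_add, ha, hb], hax.add hby, map_add _ _ _⟩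

theorem IsSeriesSum.smul (h : IsInductiveRep ι ϱ ϱE) {u : ℕ → V} {x : V} (c : ℂ)
    (hx : IsSeriesSum ι u x) : IsSeriesSum ι (fun n => c • u n) (c • x) := by
  obtain ⟨γ, a, x', ha, hax, rfl⟩ := hx
  have := (h.isLC γ).1
  have := (h.isLC γ).2.1
  exact ⟨γ, _, _, fun n => by rw [map_smul, ha], hax.const_smul c, map_smul _ _ _⟩

/-- Convergence of analytic vectors implies convergence in the underlying piece, so uniqueness can
be tested in the original system. -/
theorem isSeriesSum_of_analytic (h : IsInductiveRep ι ϱ ϱE) {N : Seminorm ℝ 𝔤} {R : ℝ}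
    {p : {r : ℝ // 0 < r}ᵒᵈ × J}
    {a : ℕ → AnalyticSpace N (ϱE p.2) R (OrderDual.ofDual p.1).1}
    {x : AnalyticSpace N (ϱE p.2) R (OrderDual.ofDual p.1).1} (hx : HasSum a x) :
    IsSeriesSum ι (fun n => (analyticIncl N ι ϱE R p (a n) : V)) (analyticIncl N ι ϱE R p x) :=
  ⟨p.2, _, _, fun _ => rfl, hx.map _ (AnalyticSpace.continuous_incl (h.isLC p.2)
    (OrderDual.ofDual p.1).2), rfl⟩

/-- A tensor is a finite sum of pure tensors, and directedness puts all their factors into one pair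
of pieces. -/
theorem IsInductiveRep.exists_tensor_eq (h : IsInductiveRep ι ϱ ϱE) {J' : Type*} [Preorder J']
    {F : J' → Type*} [∀ β, AddCommGroup (F β)] [∀ β, Module ℂ (F β)] [∀ β, TopologicalSpace (F β)]
    {W : Type*} [AddCommGroup W] [Module ℂ W] {ι' : ∀ β, F β →ₗ[ℂ] W} {ϱ' : Rep 𝔤 W}
    {ϱF : ∀ β, Rep 𝔤 (F β)} (h' : IsInductiveRep ι' ϱ' ϱF) (z : V ⊗[ℂ] W) :
    ∃ α β, ∃ z' : E α ⊗[ℂ] F β, TensorProduct.map (ι α) (ι' β) z' = z := by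
  induction z using TensorProduct.induction_on with
  | zero =>
    obtain ⟨α⟩ := h.nonempty
    obtain ⟨β⟩ := h'.nonempty
    exact ⟨α, β, 0, map_zero _⟩
  | tmul v w =>
    obtain ⟨α, x, rfl⟩ := h.exhaustive v
    obtain ⟨β, y, rfl⟩ := h'.exhaustive w
    exact ⟨α, β, x ⊗ₜ y, TensorProduct.map_tmul _ _ _ _⟩
  | add z₁ z₂ h₁ h₂ =>
    obtain ⟨α₁, β₁, z₁, rfl⟩ := h₁
    obtain ⟨α₂, β₂, z₂, rfl⟩ := h₂
    obtain ⟨α, ha₁, ha₂⟩ := h.directed α₁ α₂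
    obtain ⟨β, hb₁, hb₂⟩ := h'.directed β₁ β₂
    have key : ∀ α₁ β₁, α₁ ≤ α → β₁ ≤ β → ∀ z : E α₁ ⊗[ℂ] F β₁, ∃ z' : E α ⊗[ℂ] F β,
        TensorProduct.map (ι α) (ι' β) z' = TensorProduct.map (ι α₁) (ι' β₁) z := by
      intro α₁ β₁ ha hb z
      obtain ⟨φ, hφ⟩ := h.connecting α₁ α ha
      obtain ⟨ψ, hψ⟩ := h'.connecting β₁ β hb
      refine ⟨TensorProduct.map φ.toLinearMap ψ.toLinearMap z, ?_⟩
      rw [← LinearMap.comp_apply, ← TensorProduct.map_comp]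
      congr 2
      · exact LinearMap.ext hφ
      · exact LinearMap.ext hψ
    obtain ⟨z₁', hz₁⟩ := key α₁ β₁ ha₁ hb₁ z₁
    obtain ⟨z₂', hz₂⟩ := key α₂ β₂ ha₂ hb₂ z₂
    exact ⟨α, β, z₁' + z₂', by rw [map_add, hz₁, hz₂]⟩

end SeriesSum

/-! ### The deformed product -/

section Product

variable {𝔤 : Type*} [LieRing 𝔤] [LieAlgebra ℝ 𝔤] {N : Seminorm ℝ 𝔤}
  {JV JW JX : Type*} [Preorder JV] [Preorder JW] [Preorder JX]
  {EV : JV → Type*} [∀ α, AddCommGroup (EV α)] [∀ α, Module ℂ (EV α)]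
  [∀ α, TopologicalSpace (EV α)]
  {EW : JW → Type*} [∀ β, AddCommGroup (EW β)] [∀ β, Module ℂ (EW β)]
  [∀ β, TopologicalSpace (EW β)]
  {EX : JX → Type*} [∀ γ, AddCommGroup (EX γ)] [∀ γ, Module ℂ (EX γ)]
  [∀ γ, TopologicalSpace (EX γ)]
  {V W X : Type*} [AddCommGroup V] [Module ℂ V] [AddCommGroup W] [Module ℂ W]
  [AddCommGroup X] [Module ℂ X]
  {ιV : ∀ α, EV α →ₗ[ℂ] V} {ιW : ∀ β, EW β →ₗ[ℂ] W} {ιX : ∀ γ, EX γ →ₗ[ℂ] X}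
  {ϱV : Rep 𝔤 V} {ϱW : Rep 𝔤 W} {ϱX : Rep 𝔤 X}
  {ϱEV : ∀ α, Rep 𝔤 (EV α)} {ϱEW : ∀ β, Rep 𝔤 (EW β)} {ϱEX : ∀ γ, Rep 𝔤 (EX γ)}
  {μ : V ⊗[ℂ] W →ₗ[ℂ] X} {R : ℝ}
  {F : ℕ → UniversalEnvelopingAlgebra ℝ 𝔤 ⊗[ℝ] UniversalEnvelopingAlgebra ℝ 𝔤}

/-- The coefficients of the deformed product on the analytic vectors of an inductive triple. -/
theorem IsInductiveTriple.exists_coefficients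
    (hμ : IsInductiveTriple ιV ιW ιX ϱV ϱW ϱX ϱEV ϱEW ϱEX μ) (hmal : IsMalleable ϱV ϱW ϱX μ)
    (hR : 0 ≤ R) {α : JV} {β : JW} {γ : JX}
    (hc : RestrictsContinuously (ιV α) (ιW β) (ιX γ) μ) (r₁ r₂ : {r : ℝ // 0 < r}) {κ : ℂ}
    (hκ : κ ≠ 0) {t s : ℝ} (ht : 0 < t) (hts : t * s ≤ min r₁.1 r₂.1)
    (h : TwistEquicontinuous N (ϱEV α) (ϱEW β) R F r₁.1 r₂.1 {κ} t s)
    (r₀ : {r : ℝ // 0 < r}) (hr₀ : r₀.1 = (2 : ℝ) ^ (-R) * s) :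
    ∃ b : ℕ → AnalyticSpace N (ϱEV α) R r₁.1 ⊗[ℂ] AnalyticSpace N (ϱEW β) R r₂.1 →ₗ[ℂ]
        AnalyticSpace N (ϱEX γ) R r₀.1,
      (∀ n z, (analyticIncl N ιX ϱEX R (OrderDual.toDual r₀, γ) (b n z) : X) =
        (n.factorial : ℂ)⁻¹ • μ (tensorAction ϱV ϱW (F n)
          (TensorProduct.map (analyticUnion N ιV ϱEV R).subtype (analyticUnion N ιW ϱEW R).subtype
            (TensorProduct.map (analyticIncl N ιV ϱEV R (OrderDual.toDual r₁, α))
              (analyticIncl N ιW ϱEW R (OrderDual.toDual r₂, β)) z)))) ∧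
      ∀ i, ∃ P : Seminorm ℂ (AnalyticSpace N (ϱEV α) R r₁.1 ⊗[ℂ] AnalyticSpace N (ϱEW β) R r₂.1),
        Continuous P ∧
        ∀ n z, AnalyticSpace.seminorms N (ϱEX γ) R r₀.1 i (b n z) * ‖κ‖ ^ n ≤ P z := by
  obtain ⟨m, hm, hmc⟩ := hc
  -- Malleability holds in `X`; injectivity of `ιX γ` brings it down to the pieces.
  have hleib : ∀ ξ v w, ϱEX γ ξ (m (v ⊗ₜ w)) = m (ϱEV α ξ v ⊗ₜ w) + m (v ⊗ₜ ϱEW β ξ w) := by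
    intro ξ v w
    apply hμ.target.injective γ
    rw [hμ.target.invariant, map_add, hm, hm, hm]
    simp only [TensorProduct.map_tmul, hμ.left.invariant, hμ.right.invariant]
    rw [hmal, map_add]
  obtain ⟨b, hb, hP⟩ := h.exists_coefficients hR (hμ.left.isLC α) (hμ.right.isLC β) hmc hleib hκ ht
    hts hr₀
  refine ⟨b, fun n z => ?_, hP⟩
  show ιX γ (AnalyticSpace.incl N (ϱEX γ) R r₀.1 (b n z)) = _
  rw [hb, map_smul, hm, ← tensorAction_intertwines (hμ.left.invariant α) (hμ.right.invariant β),
    ← LinearMap.comp_apply (TensorProduct.map (ιV α) _), ← TensorProduct.map_comp]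
  exact congrArg (fun y => (n.factorial : ℂ)⁻¹ • μ (tensorAction ϱV ϱW (F n) y))
    (LinearMap.congr_fun (TensorProduct.map_comp (analyticUnion N ιV ϱEV R).subtype
      (analyticUnion N ιW ϱEW R).subtype (analyticIncl N ιV ϱEV R (OrderDual.toDual r₁, α))
      (analyticIncl N ιW ϱEW R (OrderDual.toDual r₂, β))) z)

end Product

section Product

variable {𝔤 : Type*} [LieRing 𝔤] [LieAlgebra ℝ 𝔤] {N : Seminorm ℝ 𝔤}
  {JV JW JX : Type*} [Preorder JV] [Preorder JW] [Preorder JX]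
  {EV : JV → Type*} [∀ α, AddCommGroup (EV α)] [∀ α, Module ℂ (EV α)]
  [∀ α, TopologicalSpace (EV α)]
  {EW : JW → Type*} [∀ β, AddCommGroup (EW β)] [∀ β, Module ℂ (EW β)]
  [∀ β, TopologicalSpace (EW β)]
  {EX : JX → Type*} [∀ γ, AddCommGroup (EX γ)] [∀ γ, Module ℂ (EX γ)]
  [∀ γ, TopologicalSpace (EX γ)]
  {V W X : Type*} [AddCommGroup V] [Module ℂ V] [AddCommGroup W] [Module ℂ W]
  [AddCommGroup X] [Module ℂ X]
  {ιV : ∀ α, EV α →ₗ[ℂ] V} {ιW : ∀ β, EW β →ₗ[ℂ] W} {ιX : ∀ γ, EX γ →ₗ[ℂ] X}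
  {ϱV : Rep 𝔤 V} {ϱW : Rep 𝔤 W} {ϱX : Rep 𝔤 X}
  {ϱEV : ∀ α, Rep 𝔤 (EV α)} {ϱEW : ∀ β, Rep 𝔤 (EW β)} {ϱEX : ∀ γ, Rep 𝔤 (EX γ)}
  {μ : V ⊗[ℂ] W →ₗ[ℂ] X} {R : ℝ}
  {F : ℕ → UniversalEnvelopingAlgebra ℝ 𝔤 ⊗[ℝ] UniversalEnvelopingAlgebra ℝ 𝔤}

/-- The terms of the series defining the deformed product. -/
def twistedTerm (N : Seminorm ℝ 𝔤) (ιV : ∀ α, EV α →ₗ[ℂ] V) (ιW : ∀ β, EW β →ₗ[ℂ] W)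
    (ϱV : Rep 𝔤 V) (ϱW : Rep 𝔤 W) (ϱEV : ∀ α, Rep 𝔤 (EV α)) (ϱEW : ∀ β, Rep 𝔤 (EW β))
    (μ : V ⊗[ℂ] W →ₗ[ℂ] X) (R : ℝ)
    (F : ℕ → UniversalEnvelopingAlgebra ℝ 𝔤 ⊗[ℝ] UniversalEnvelopingAlgebra ℝ 𝔤) (ħ : ℂ) (n : ℕ) :
    analyticUnion N ιV ϱEV R ⊗[ℂ] analyticUnion N ιW ϱEW R →ₗ[ℂ] X :=
  (ħ ^ n / (n.factorial : ℂ)) • μ ∘ₗ tensorAction ϱV ϱW (F n) ∘ₗ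
    TensorProduct.map (analyticUnion N ιV ϱEV R).subtype (analyticUnion N ιW ϱEW R).subtype

/-- Local form of the deformed product: a power series with values in a fixed space of analytic
vectors. -/
theorem IsInductiveTriple.exists_local_product
    (hμ : IsInductiveTriple ιV ιW ιX ϱV ϱW ϱX ϱEV ϱEW ϱEX μ) (hmal : IsMalleable ϱV ϱW ϱX μ)
    (hX : ∀ γ, T2Space (EX γ) ∧ IsSeqComplete (EX γ))
    (hR : 0 ≤ R) {α : JV} {β : JW} {γ : JX}
    (hc : RestrictsContinuously (ιV α) (ιW β) (ιX γ) μ) (r₁ r₂ : {r : ℝ // 0 < r}) {κ : ℂ}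
    (hκ : κ ≠ 0) {t s : ℝ} (ht : 0 < t) (hts : t * s ≤ min r₁.1 r₂.1)
    (h : TwistEquicontinuous N (ϱEV α) (ϱEW β) R F r₁.1 r₂.1 {κ} t s)
    (r₀ : {r : ℝ // 0 < r}) (hr₀ : r₀.1 = (2 : ℝ) ^ (-R) * s) :
    ∃ f : ℂ × (AnalyticSpace N (ϱEV α) R r₁.1 ⊗[ℂ] AnalyticSpace N (ϱEW β) R r₂.1) →
        AnalyticSpace N (ϱEX γ) R r₀.1,
      (∀ ħ : ℂ, ‖ħ‖ < ‖κ‖ → ∀ z, ∃ a : ℕ → AnalyticSpace N (ϱEX γ) R r₀.1,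
        (∀ n, (analyticIncl N ιX ϱEX R (OrderDual.toDual r₀, γ) (a n) : X) =
          twistedTerm N ιV ιW ϱV ϱW ϱEV ϱEW μ R F ħ n
            (TensorProduct.map (analyticIncl N ιV ϱEV R (OrderDual.toDual r₁, α))
              (analyticIncl N ιW ϱEW R (OrderDual.toDual r₂, β)) z)) ∧
        HasSum a (f (ħ, z))) ∧
      (∀ ħ : ℂ, ‖ħ‖ < ‖κ‖ → ∃ m : AnalyticSpace N (ϱEV α) R r₁.1 ⊗[ℂ]
        AnalyticSpace N (ϱEW β) R r₂.1 →ₗ[ℂ] AnalyticSpace N (ϱEX γ) R r₀.1,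
        (∀ z, m z = f (ħ, z)) ∧ Continuous m) ∧
      FrechetHolomorphicOn f (Metric.ball 0 ‖κ‖ ×ˢ Set.univ) := by
  obtain ⟨b, hb, hP⟩ := hμ.exists_coefficients hmal hR hc r₁ r₂ hκ ht hts h r₀ hr₀
  have hG := AnalyticSpace.summable_of_seminorms (N := N) (R := R) (hμ.target.isLC γ) (hX γ).2
    (hμ.target.continuous_piece γ) r₀.2
  have hp := AnalyticSpace.withSeminorms N (ϱEX γ) R r₀.1
  have := (hX γ).1
  have := AnalyticSpace.t2Space (N := N) (ϱ := ϱEX γ) (R := R) (hμ.target.isLC γ) r₀.2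
  have : IsTopologicalAddGroup
      (AnalyticSpace N (ϱEV α) R r₁.1 ⊗[ℂ] AnalyticSpace N (ϱEW β) R r₂.1) :=
    isLCTopology_projective.1
  refine ⟨fun x => ∑' n, x.1 ^ n • b n x.2, fun ħ hħ z => ⟨fun n => ħ ^ n • b n z, fun n => ?_,
    (powerSeries_summable hG hP hħ z).hasSum⟩, fun ħ hħ =>
      exists_powerSeries_linearMap hp hG hP hħ, frechetHolomorphicOn_powerSeries hp hG hP⟩
  have h1 := hb n z
  calc _ = ħ ^ n • (analyticIncl N ιX ϱEX R (OrderDual.toDual r₀, γ) (b n z) : X) :=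
        congrArg Subtype.val ((analyticIncl N ιX ϱEX R (OrderDual.toDual r₀, γ)).map_smul _ _)
    _ = _ := by
        rw [h1, smul_smul, ← div_eq_mul_inv]
        rfl

/-- For a fixed deformation parameter, the deformed product is locally a continuous linear map. -/
theorem IsInductiveTriple.exists_local_map
    (hμ : IsInductiveTriple ιV ιW ιX ϱV ϱW ϱX ϱEV ϱEW ϱEX μ) (hmal : IsMalleable ϱV ϱW ϱX μ)
    (hX : ∀ γ, T2Space (EX γ) ∧ IsSeqComplete (EX γ)) (hR : 0 ≤ R)
    (hF : ∀ α β, ∀ r₁ > 0, ∀ r₂ > 0, ∀ K : Set ℂ, IsCompact K → ∃ t > 0,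
      TwistEquicontinuous N (ϱEV α) (ϱEW β) R F r₁ r₂ K t ((2 : ℝ) ^ (-R) / t * min r₁ r₂))
    (ħ : ℂ) (p₁ : {r : ℝ // 0 < r}ᵒᵈ × JV) (p₂ : {r : ℝ // 0 < r}ᵒᵈ × JW) :
    ∃ (p : {r : ℝ // 0 < r}ᵒᵈ × JX)
      (m : AnalyticSpace N (ϱEV p₁.2) R (OrderDual.ofDual p₁.1).1 ⊗[ℂ]
        AnalyticSpace N (ϱEW p₂.2) R (OrderDual.ofDual p₂.1).1 →ₗ[ℂ]
          AnalyticSpace N (ϱEX p.2) R (OrderDual.ofDual p.1).1), Continuous m ∧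
      ∀ z, ∃ a : ℕ → AnalyticSpace N (ϱEX p.2) R (OrderDual.ofDual p.1).1,
        (∀ n, (analyticIncl N ιX ϱEX R p (a n) : X) =
          twistedTerm N ιV ιW ϱV ϱW ϱEV ϱEW μ R F ħ n
            (TensorProduct.map (analyticIncl N ιV ϱEV R p₁) (analyticIncl N ιW ϱEW R p₂) z)) ∧
        HasSum a (m z) := by
  obtain ⟨r₁, α⟩ := p₁
  obtain ⟨r₂, β⟩ := p₂
  obtain ⟨γ, hc⟩ := hμ.continuity α β
  -- Any parameter of modulus larger than `‖ħ‖` serves; the twist condition is needed only on the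
  -- singleton `{κ}`.
  let κ : ℂ := ((‖ħ‖ + 1 : ℝ) : ℂ)
  have hκ : ‖κ‖ = ‖ħ‖ + 1 := by
    rw [Complex.norm_real, Real.norm_of_nonneg (by positivity)]
  have hħ : ‖ħ‖ < ‖κ‖ := by rw [hκ]; exact lt_add_one _
  have hκ0 : κ ≠ 0 := norm_pos_iff.1 ((norm_nonneg ħ).trans_lt hħ)
  have h₁ : 0 < (OrderDual.ofDual r₁).1 := (OrderDual.ofDual r₁).2
  have h₂ : 0 < (OrderDual.ofDual r₂).1 := (OrderDual.ofDual r₂).2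
  have hmin := lt_min h₁ h₂
  obtain ⟨t, ht, h⟩ := hF α β _ h₁ _ h₂ {κ} isCompact_singleton
  have h2 : (2 : ℝ) ^ (-R) ≤ 1 := Real.rpow_le_one_of_one_le_of_nonpos one_le_two (by linarith)
  -- For this choice of `s` the product `t s` is `2^(-R)` times the minimum, and `2^(-R) ≤ 1` since
  -- `R ≥ 0`.
  have hts : t * ((2 : ℝ) ^ (-R) / t * min (OrderDual.ofDual r₁).1 (OrderDual.ofDual r₂).1) ≤
      min (OrderDual.ofDual r₁).1 (OrderDual.ofDual r₂).1 := by
    rw [← mul_assoc, mul_div_cancel₀ _ ht.ne']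
    exact mul_le_of_le_one_left hmin.le h2
  obtain ⟨f, hf, hm, -⟩ := hμ.exists_local_product hmal hX hR hc (OrderDual.ofDual r₁)
    (OrderDual.ofDual r₂) hκ0 ht hts h ⟨(2 : ℝ) ^ (-R) * _, by positivity⟩ rfl
  obtain ⟨m, hmf, hmc⟩ := hm ħ hħ
  refine ⟨(OrderDual.toDual _, γ), m, hmc, fun z => ?_⟩
  obtain ⟨a, ha, has⟩ := hf ħ hħ z
  exact ⟨a, ha, (hmf z).symm ▸ has⟩

/-- The deformed product on the analytic vectors of an inductive triple. -/
theorem IsInductiveTriple.exists_deformed_product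
    (hμ : IsInductiveTriple ιV ιW ιX ϱV ϱW ϱX ϱEV ϱEW ϱEX μ) (hmal : IsMalleable ϱV ϱW ϱX μ)
    (hX : ∀ γ, T2Space (EX γ) ∧ IsSeqComplete (EX γ)) (hR : 0 ≤ R)
    (hF : ∀ α β, ∀ r₁ > 0, ∀ r₂ > 0, ∀ K : Set ℂ, IsCompact K → ∃ t > 0,
      TwistEquicontinuous N (ϱEV α) (ϱEW β) R F r₁ r₂ K t ((2 : ℝ) ^ (-R) / t * min r₁ r₂)) :
    ∃ μF : ℂ → analyticUnion N ιV ϱEV R ⊗[ℂ] analyticUnion N ιW ϱEW R →ₗ[ℂ]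
        analyticUnion N ιX ϱEX R,
      ∀ ħ z, ∃ (p : {r : ℝ // 0 < r}ᵒᵈ × JX)
        (a : ℕ → AnalyticSpace N (ϱEX p.2) R (OrderDual.ofDual p.1).1)
        (x : AnalyticSpace N (ϱEX p.2) R (OrderDual.ofDual p.1).1),
        (∀ n, (analyticIncl N ιX ϱEX R p (a n) : X) =
          twistedTerm N ιV ιW ϱV ϱW ϱEV ϱEW μ R F ħ n z) ∧
        HasSum a x ∧ analyticIncl N ιX ϱEX R p x = μF ħ z := by
  obtain ⟨σV, σEV, -, hV⟩ := hμ.left.analytic N hR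
  obtain ⟨σW, σEW, -, hW⟩ := hμ.right.analytic N hR
  have hex : ∀ ħ z, ∃ (y : analyticUnion N ιX ϱEX R) (p : {r : ℝ // 0 < r}ᵒᵈ × JX)
        (a : ℕ → AnalyticSpace N (ϱEX p.2) R (OrderDual.ofDual p.1).1)
        (x : AnalyticSpace N (ϱEX p.2) R (OrderDual.ofDual p.1).1),
        (∀ n, (analyticIncl N ιX ϱEX R p (a n) : X) =
          twistedTerm N ιV ιW ϱV ϱW ϱEV ϱEW μ R F ħ n z) ∧
        HasSum a x ∧ analyticIncl N ιX ϱEX R p x = y := by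
    intro ħ z
    obtain ⟨p₁, p₂, z, rfl⟩ := hV.exists_tensor_eq hW z
    obtain ⟨p, m, -, hm⟩ := hμ.exists_local_map hmal hX hR hF ħ p₁ p₂
    obtain ⟨a, ha, has⟩ := hm z
    exact ⟨_, p, a, m z, ha, has, rfl⟩
  choose g hg using hex
  have hsum : ∀ ħ z, IsSeriesSum ιX (fun n => twistedTerm N ιV ιW ϱV ϱW ϱEV ϱEW μ R F ħ n z)
      (g ħ z) := by
    intro ħ z
    obtain ⟨p, a, x, ha, hx, hy⟩ := hg ħ z
    rw [← hy, ← funext ha]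
    exact isSeriesSum_of_analytic hμ.target hx
  have hT := fun γ => (hX γ).1
  -- The values `g ħ z` were chosen separately for each `z`; linearity is recovered from uniqueness
  -- of sums of series.
  refine ⟨fun ħ => ⟨⟨g ħ, fun z w => Subtype.ext ?_⟩, fun c z => Subtype.ext ?_⟩, hg⟩
  · refine (hsum ħ (z + w)).unique hμ.target hT ?_
    simp only [map_add]
    exact (hsum ħ z).add hμ.target (hsum ħ w)
  · refine (hsum ħ (c • z)).unique hμ.target hT ?_
    simp only [map_smul]
    exact (hsum ħ z).smul hμ.target c

end Product

end GTriple

end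

/-! ### Assembly of the theorem -/

theorem mainTheorem2
    {𝔤 : Type*} [LieRing 𝔤] [LieAlgebra ℝ 𝔤] [FiniteDimensional ℝ 𝔤]
    (N : Seminorm ℝ 𝔤) (hN : ∀ ξ, N ξ = 0 → ξ = 0)
    {JV JW JX : Type*} [Preorder JV] [Preorder JW] [Preorder JX]
    {EV : JV → Type*} [∀ α, AddCommGroup (EV α)] [∀ α, Module ℂ (EV α)]
    [∀ α, TopologicalSpace (EV α)]
    {EW : JW → Type*} [∀ β, AddCommGroup (EW β)] [∀ β, Module ℂ (EW β)]
    [∀ β, TopologicalSpace (EW β)]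
    {EX : JX → Type*} [∀ γ, AddCommGroup (EX γ)] [∀ γ, Module ℂ (EX γ)]
    [∀ γ, TopologicalSpace (EX γ)]
    {V W X : Type*} [AddCommGroup V] [Module ℂ V] [AddCommGroup W] [Module ℂ W]
    [AddCommGroup X] [Module ℂ X]
    (ιV : ∀ α, EV α →ₗ[ℂ] V) (ιW : ∀ β, EW β →ₗ[ℂ] W) (ιX : ∀ γ, EX γ →ₗ[ℂ] X)
    (ϱV : GTriple.Rep 𝔤 V) (ϱW : GTriple.Rep 𝔤 W)
    (ϱX : GTriple.Rep 𝔤 X)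
    (ϱEV : ∀ α, GTriple.Rep 𝔤 (EV α)) (ϱEW : ∀ β, GTriple.Rep 𝔤 (EW β))
    (ϱEX : ∀ γ, GTriple.Rep 𝔤 (EX γ))
    (μ : V ⊗[ℂ] W →ₗ[ℂ] X)
    (hμ : GTriple.IsInductiveTriple ιV ιW ιX ϱV ϱW ϱX ϱEV ϱEW ϱEX μ)
    (hmal : GTriple.IsMalleable ϱV ϱW ϱX μ)
    (hX : ∀ γ, T2Space (EX γ) ∧ GTriple.IsSeqComplete (EX γ))
    (R : ℝ) (hR : 0 ≤ R)
    (F : ℕ → UniversalEnvelopingAlgebra ℝ 𝔤 ⊗[ℝ] UniversalEnvelopingAlgebra ℝ 𝔤)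
    (hF : ∀ α β, ∀ r₁ > 0, ∀ r₂ > 0, ∀ K : Set ℂ, IsCompact K → ∃ t > 0,
      GTriple.TwistEquicontinuous N (ϱEV α) (ϱEW β) R F r₁ r₂ K t
        ((2 : ℝ) ^ (-R) / t * min r₁ r₂)) :
    ∃ (σV : GTriple.Rep 𝔤 (GTriple.analyticUnion N ιV ϱEV R))
      (σW : GTriple.Rep 𝔤 (GTriple.analyticUnion N ιW ϱEW R))
      (σX : GTriple.Rep 𝔤 (GTriple.analyticUnion N ιX ϱEX R))
      (σEV : ∀ p : {r : ℝ // 0 < r}ᵒᵈ × JV, GTriple.Rep 𝔤 (GTriple.AnalyticSpace N (ϱEV p.2) R (OrderDual.ofDual p.1).1))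
      (σEW : ∀ p : {r : ℝ // 0 < r}ᵒᵈ × JW, GTriple.Rep 𝔤 (GTriple.AnalyticSpace N (ϱEW p.2) R (OrderDual.ofDual p.1).1))
      (σEX : ∀ p : {r : ℝ // 0 < r}ᵒᵈ × JX, GTriple.Rep 𝔤 (GTriple.AnalyticSpace N (ϱEX p.2) R (OrderDual.ofDual p.1).1))
      (μF : ℂ → (GTriple.analyticUnion N ιV ϱEV R) ⊗[ℂ] (GTriple.analyticUnion N ιW ϱEW R) →ₗ[ℂ]
        (GTriple.analyticUnion N ιX ϱEX R)),
      -- the representations on the spaces of analytic vectors are the restrictions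
      (∀ ξ v, (σV ξ v : V) = ϱV ξ (v : V)) ∧
      (∀ ξ w, (σW ξ w : W) = ϱW ξ (w : W)) ∧
      (∀ ξ x, (σX ξ x : X) = ϱX ξ (x : X)) ∧
      -- `μF ħ` is the convergent series `μ ∘ ϱ(F_ħ)`
      (∀ ħ z, ∃ (p : {r : ℝ // 0 < r}ᵒᵈ × JX)
        (a : ℕ → GTriple.AnalyticSpace N (ϱEX p.2) R (OrderDual.ofDual p.1).1)
        (x : GTriple.AnalyticSpace N (ϱEX p.2) R (OrderDual.ofDual p.1).1),
        (∀ n, (GTriple.analyticIncl N ιX ϱEX R p (a n) : X) =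
          (ħ ^ n / (n.factorial : ℂ)) • μ (GTriple.tensorAction ϱV ϱW (F n)
            (TensorProduct.map (GTriple.analyticUnion N ιV ϱEV R).subtype
              (GTriple.analyticUnion N ιW ϱEW R).subtype z))) ∧
        HasSum a x ∧ GTriple.analyticIncl N ιX ϱEX R p x = μF ħ z) ∧
      -- the spaces of analytic vectors form an inductive triple with respect to `μF ħ`
      (∀ ħ, GTriple.IsInductiveTriple (GTriple.analyticIncl N ιV ϱEV R)
        (GTriple.analyticIncl N ιW ϱEW R) (GTriple.analyticIncl N ιX ϱEX R)
        σV σW σX σEV σEW σEX (μF ħ)) ∧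
      -- holomorphic dependence on the deformation parameter
      (∀ α β γ, GTriple.RestrictsContinuously (ιV α) (ιW β) (ιX γ) μ →
        ∀ (r₁ r₂ : {r : ℝ // 0 < r}) (K : Set ℂ), IsCompact K → ∀ t > 0, ∀ s : {s : ℝ // 0 < s},
          t * s.1 ≤ min r₁.1 r₂.1 →
          GTriple.TwistEquicontinuous N (ϱEV α) (ϱEW β) R F r₁.1 r₂.1 K t s.1 →
          ∀ r₀ : {r : ℝ // 0 < r}, r₀.1 = (2 : ℝ) ^ (-R) * s.1 →
          ∃ f : ℂ × (GTriple.AnalyticSpace N (ϱEV α) R r₁.1 ⊗[ℂ]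
              GTriple.AnalyticSpace N (ϱEW β) R r₂.1) → GTriple.AnalyticSpace N (ϱEX γ) R r₀.1,
            (∀ ħ ∈ interior K, ∀ z, GTriple.analyticIncl N ιX ϱEX R (OrderDual.toDual r₀, γ)
              (f (ħ, z)) = μF ħ (TensorProduct.map
                (GTriple.analyticIncl N ιV ϱEV R (OrderDual.toDual r₁, α))
                (GTriple.analyticIncl N ιW ϱEW R (OrderDual.toDual r₂, β)) z)) ∧
            GTriple.FrechetHolomorphicOn f (interior K ×ˢ Set.univ)) := by
  obtain ⟨σV, σEV, hσV, hV⟩ := hμ.left.analytic N hR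
  obtain ⟨σW, σEW, hσW, hW⟩ := hμ.right.analytic N hR
  obtain ⟨σX, σEX, hσX, hXa⟩ := hμ.target.analytic N hR
  obtain ⟨μF, hμF⟩ := hμ.exists_deformed_product hmal hX hR hF
  have hT := fun γ => (hX γ).1
  -- A local sum in any piece agrees with `μF`, whatever piece was used to define `μF ħ z`.
  have hval : ∀ ħ z (p : {r : ℝ // 0 < r}ᵒᵈ × JX)
      (a : ℕ → GTriple.AnalyticSpace N (ϱEX p.2) R (OrderDual.ofDual p.1).1)
      (x : GTriple.AnalyticSpace N (ϱEX p.2) R (OrderDual.ofDual p.1).1),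
      (∀ n, (GTriple.analyticIncl N ιX ϱEX R p (a n) : X) =
        GTriple.twistedTerm N ιV ιW ϱV ϱW ϱEV ϱEW μ R F ħ n z) →
      HasSum a x → GTriple.analyticIncl N ιX ϱEX R p x = μF ħ z := by
    intro ħ z p a x ha hx
    obtain ⟨p', a', x', ha', hx', hy'⟩ := hμF ħ z
    rw [← hy']
    have h1 := GTriple.isSeriesSum_of_analytic hμ.target hx
    have h2 := GTriple.isSeriesSum_of_analytic hμ.target hx'
    rw [funext ha] at h1
    rw [funext ha'] at h2
    exact Subtype.ext (h1.unique hμ.target hT h2)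
  refine ⟨σV, σW, σX, σEV, σEW, σEX, μF, hσV, hσW, hσX, hμF,
    fun ħ => ⟨hV, hW, hXa, fun p₁ p₂ => ?_⟩, ?_⟩
  · obtain ⟨p, m, hmc, hm⟩ := hμ.exists_local_map hmal hX hR hF ħ p₁ p₂
    refine ⟨p, m, fun z => ?_, hmc⟩
    obtain ⟨a, ha, has⟩ := hm z
    exact hval ħ _ p a _ ha has
  · intro α β γ hc r₁ r₂ K hK t ht s hts h r₀ hr₀
    -- An empty interior leaves nothing to prove but may rule out a nonzero `κ` in `K`, so it is
    -- treated apart.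
    rcases (interior K).eq_empty_or_nonempty with hemp | hne
    · refine ⟨fun _ => 0, fun ħ hħ => by simp [hemp] at hħ, continuousOn_const, fun x _ y φ => ?_⟩
      simpa using analyticAt_const
    -- With `κ ∈ K` of maximal modulus, `K` lies in the closed disc of radius `‖κ‖`, and taking
    -- interiors gives the strict inequality needed for convergence.
    · obtain ⟨κ, hκK, hκ⟩ := hK.exists_isMaxOn (hne.mono interior_subset)
        continuous_norm.continuousOn
      have hsub : interior K ⊆ Metric.ball 0 ‖κ‖ := by
        rw [← interior_closedBall' (0 : ℂ) ‖κ‖]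
        exact interior_mono fun ħ hħ => mem_closedBall_zero_iff.2 (hκ hħ)
      have hκ0 : κ ≠ 0 := by
        obtain ⟨ħ, hħ⟩ := hne
        exact norm_pos_iff.1 ((norm_nonneg ħ).trans_lt (mem_ball_zero_iff.1 (hsub hħ)))
      obtain ⟨f, hf, -, hhol⟩ := hμ.exists_local_product hmal hX hR hc r₁ r₂ hκ0 ht hts
        (h.mono (Set.singleton_subset_iff.2 hκK)) r₀ hr₀
      refine ⟨f, fun ħ hħ z => ?_, hhol.mono (Set.prod_mono_left hsub)⟩
      obtain ⟨a, ha, has⟩ := hf ħ (mem_ball_zero_iff.1 (hsub hħ)) z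
      exact hval ħ _ (OrderDual.toDual r₀, γ) a _ ha has
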